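/- Oriented links in $S^3$ are considered up to ambient isotopy; they are represented by oriented link diagrams modulo planar isotopy and Reidemeister moves. A Conway polynomial is an assignment $L\mapsto\nabla_L(z)\in\mathbb{Z}[z]$ on oriented links such that $\nabla_{\mathrm{unknot}}(z)=1$ and $\nabla_{L_+}(z)-\nabla_{L_-}(z)=z\,\nabla_{L_0}(z)$ whenever $L_+,L_-,L_0$ have diagrams that coincide except near one point, where they show, respectively, a positive crossing, a negative crossing, and the oriented smoothing of the crossing. Read diagrams from bottom to top, number the strands at each height from left to right, and write $\cup_i$ for a minimum whose two strands become the $i$-th and $(i+1)$-st, $\cap_i$ for a maximum that joins the $i$-th and $(i+1)$-st strands, and $\sigma_i$ (resp. $\sigma_i^{-1}$) for a crossing of the $i$-th and $(i+1)$-st strands in which the strand running from bottom left to top right passes over (resp. under). For $n\in\mathbb{Z}$ let $K_n$ be the knot with diagram $$\cup_1\;\cup_2\;\sigma_1^{2}\;\sigma_2^{-1}\;\cup_3\;\sigma_4^{-2}\;\sigma_5\;\cdot\;\sigma_4^{-(2n-1)}\;\cdot\;\sigma_3\;\sigma_4^{-2}\;\cap_2\;\cap_1\;\cap_1 ,$$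 oriented so that the left strand of the minimum $\cup_1$ points downward. (The block $\sigma_4^{-(2n-1)}$ consists of $2n-1$ half twists of two antiparallel strands, with $|2n-1|$ crossings, positive if $n>0$ and negative if $n\le 0$; $K_0=\overline{3_1}\#4_1$ and $K_1=10_{97}$.) Let $J$ be the oriented two-component link obtained from $K_n$ by smoothing one crossing of this block; removing the remaining kinks, it has the diagram above with $\sigma_4^{-(2n-1)}$ replaced by $\cap_4\,\cup_4$, and does not depend on $n$. **Proposition.** The Conway polynomial exists. It satisfies $\nabla_J(z)=-4z^3+2z$ and, for every integer $n$, $$\nabla_{K_n}(z)=-(4n+1)z^4+2nz^2+1 .$$ The knots $K_n$ $(n\in\mathbb{Z})$ are pairwise distinct: $K_m\neq K_n$ as oriented links whenever $m\ne n$. -/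

import Mathlib

open Polynomial

/-! Oriented links are represented by oriented link diagrams in the plane, in general position with
respect to the height function, and considered up to planar isotopy and Reidemeister moves (by
Reidemeister's theorem, the classes are the oriented links in the three-sphere up to ambient
isotopy). A diagram is read from bottom to top as a word of horizontal layers, each of which
contains exactly one minimum, maximum or crossing besides vertical strands. A horizontal line
between two layers meets the diagram in finitely many strands; the orientations of these strands,
from left to right, form a list of Booleans, in which `true` means upward and `false` downward. -/

namespace LinkDiagram

/-- The elementary pieces of a diagram: `cup b` is a local minimum whose left strand has
orientation `b` (and whose right strand has the opposite one); `cap` is a local maximum;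
`cross true` is a crossing of two strands in which the strand from bottom left to top right runs
over the other one, and `cross false` is a crossing in which it runs under. -/
inductive Piece
  | cup (b : Bool)
  | cap
  | cross (s : Bool)

/-- The number of strands that enter a piece from below. -/
def Piece.inputs : Piece → ℕ
  | .cup _ => 0
  | .cap => 2
  | .cross _ => 2

/-- The number of strands that leave a piece at the top. -/
def Piece.outputs : Piece → ℕ
  | .cup _ => 2
  | .cap => 0
  | .cross _ => 2

/-- A layer: a piece with `pos` vertical strands to its left
(and any number of vertical strands to its right). -/
structure Layer where
  piece : Piece
  pos : ℕ

/-- The orientations above a piece that has `pos` strands to its left, given those below it;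
`none` if there are too few strands, or if a maximum would join strands whose
orientations do not fit together. -/
def Piece.act : Piece → ℕ → List Bool → Option (List Bool)
  | .cup b, 0, l => some (b :: (!b) :: l)
  | .cap, 0, a :: b :: l => if b = !a then some l else none
  | .cross _, 0, a :: b :: l => some (b :: a :: l)
  | p, i + 1, a :: l => (p.act i l).map (List.cons a)
  | _, _, _ => none

/-- The orientations above a word of layers (listed from bottom to top), given those below it. -/
def run : List Layer → List Bool → Option (List Bool)
  | [], l => some l
  | x :: w, l => (x.piece.act x.pos l).bind (run w)

/-- An oriented link diagram: a word of layers without free ends at the bottom and at the top,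
in which all orientations fit together. -/
structure Diagram where
  word : List Layer
  closed : run word [] = some []

/-- The local moves: planar isotopies (the first five) and Reidemeister moves. -/
inductive LocalMove : List Layer → List Layer → Prop
  /-- Two pieces that lie side by side exchange their heights. -/
  | exchange (p q : Piece) (i k : ℕ) :
      LocalMove [⟨p, i⟩, ⟨q, i + p.outputs + k⟩] [⟨q, i + p.inputs + k⟩, ⟨p, i⟩]
  /-- A minimum and a maximum on the same strand cancel. -/
  | zigzagLeft (b : Bool) (i : ℕ) : LocalMove [⟨.cup b, i⟩, ⟨.cap, i + 1⟩] []
  | zigzagRight (b : Bool) (i : ℕ) : LocalMove [⟨.cup b, i + 1⟩, ⟨.cap, i⟩] []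
  /-- A crossing slides over a maximum from one side to the other. -/
  | slideCap (s : Bool) (i : ℕ) :
      LocalMove [⟨.cross s, i + 1⟩, ⟨.cap, i⟩] [⟨.cross (!s), i⟩, ⟨.cap, i + 1⟩]
  /-- A crossing slides through a minimum from one side to the other. -/
  | slideCup (b s : Bool) (i : ℕ) :
      LocalMove [⟨.cup b, i⟩, ⟨.cross s, i + 1⟩] [⟨.cup b, i + 1⟩, ⟨.cross (!s), i⟩]
  /-- First Reidemeister move. -/
  | reidemeisterOneCup (b s : Bool) (i : ℕ) :
      LocalMove [⟨.cup b, i⟩, ⟨.cross s, i⟩] [⟨.cup (!b), i⟩]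
  | reidemeisterOneCap (s : Bool) (i : ℕ) :
      LocalMove [⟨.cross s, i⟩, ⟨.cap, i⟩] [⟨.cap, i⟩]
  /-- Second Reidemeister move. -/
  | reidemeisterTwo (s : Bool) (i : ℕ) : LocalMove [⟨.cross s, i⟩, ⟨.cross (!s), i⟩] []
  /-- Third Reidemeister move. The hypothesis says that the three strands lie at three different
  levels (it excludes the two patterns in which they lie cyclically above each other). -/
  | reidemeisterThree (s t r : Bool) (i : ℕ) (h : s = t ∨ t = r) :
      LocalMove [⟨.cross s, i⟩, ⟨.cross t, i + 1⟩, ⟨.cross r, i⟩]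
        [⟨.cross r, i + 1⟩, ⟨.cross t, i⟩, ⟨.cross s, i + 1⟩]

/-- Two diagrams differ by one local move. -/
def Move (D E : Diagram) : Prop :=
  ∃ u l r v : List Layer, LocalMove l r ∧ D.word = u ++ l ++ v ∧ E.word = u ++ r ++ v

end LinkDiagram

open LinkDiagram

/-- Oriented links up to isotopy: diagrams modulo the equivalence relation generated by the
local moves. -/
def OrientedLink : Type := Quot Move

/-- The link that is represented by a diagram. -/
def LinkDiagram.Diagram.link (D : Diagram) : OrientedLink := Quot.mk Move D

/-- The unknot: a circle without crossings. -/
def unknot : OrientedLink := Diagram.link ⟨[⟨.cup true, 0⟩, ⟨.cap, 0⟩], rfl⟩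

/-- `(Lp, Lm, L0)` is a skein triple: the three links have diagrams that coincide except in
the neighborhood of a point, where (after a rotation) two upward strands
form a positive crossing in `Lp`, a negative crossing in `Lm`, and are parallel in `L0`. -/
def IsSkeinTriple (Lp Lm L0 : OrientedLink) : Prop :=
  ∃ (Dp Dm D0 : Diagram) (u v : List Layer) (i : ℕ) (l : List Bool),
    Dp.link = Lp ∧ Dm.link = Lm ∧ D0.link = L0 ∧
    run u [] = some l ∧ l[i]? = some true ∧ l[i + 1]? = some true ∧
    Dp.word = u ++ [⟨.cross true, i⟩] ++ v ∧
    Dm.word = u ++ [⟨.cross false, i⟩] ++ v ∧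
    D0.word = u ++ v

/-- `nabla` is the Conway polynomial, as characterized by its value at the unknot and by
the skein relation. -/
def IsConwayPolynomial (nabla : OrientedLink → ℤ[X]) : Prop :=
  nabla unknot = 1 ∧
    ∀ Lp Lm L0 : OrientedLink, IsSkeinTriple Lp Lm L0 → nabla Lp - nabla Lm = X * nabla L0

namespace KnotFamily

/-- The part of the diagram of the knots below the twisted strands. -/
def lower : List Layer :=
  [⟨.cup false, 0⟩, ⟨.cup true, 1⟩, ⟨.cross true, 0⟩, ⟨.cross true, 0⟩, ⟨.cross false, 1⟩,
    ⟨.cup true, 2⟩, ⟨.cross false, 3⟩, ⟨.cross false, 3⟩, ⟨.cross true, 4⟩]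

/-- The part of the diagram of the knots above the twisted strands. -/
def upper : List Layer :=
  [⟨.cross true, 2⟩, ⟨.cross false, 3⟩, ⟨.cross false, 3⟩, ⟨.cap, 1⟩, ⟨.cap, 0⟩, ⟨.cap, 0⟩]

/-- `m` half twists of the fourth and the fifth strand, which are antiparallel: `|m|` crossings,
which are positive for `m > 0` and negative for `m < 0`. -/
def halfTwists (m : ℤ) : List Layer :=
  List.replicate m.natAbs ⟨.cross (decide (m < 0)), 3⟩

lemma run_append (u v : List Layer) (l : List Bool) :
    run (u ++ v) l = (run u l).bind (run v) := by
  induction u generalizing l with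
  | nil => rfl
  | cons x u ih =>
    simp only [List.cons_append, run]
    cases x.piece.act x.pos l with
    | none => rfl
    | some l' => exact ih l'

lemma run_replicate (s : Bool) (k : ℕ) :
    run (List.replicate (2 * k + 1) ⟨.cross s, 3⟩) [false, false, true, false, true, true] =
      some [false, false, true, true, false, true] := by
  induction k with
  | zero => rfl
  | succ k ih => exact ih

lemma closed (n : ℤ) : run (lower ++ halfTwists (2 * n - 1) ++ upper) [] = some [] := by
  have h : run lower [] = some [false, false, true, false, true, true] := rfl
  obtain ⟨k, hk⟩ : ∃ k, (2 * n - 1).natAbs = 2 * k + 1 := ⟨((2 * n - 1).natAbs - 1) / 2, by omega⟩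
  rw [run_append, run_append, h, Option.bind_some, halfTwists, hk, run_replicate]
  rfl

end KnotFamily

/-- The knot `K n`, with `2 * n - 1` half twists. -/
def knotK (n : ℤ) : OrientedLink :=
  Diagram.link ⟨KnotFamily.lower ++ KnotFamily.halfTwists (2 * n - 1) ++ KnotFamily.upper,
    KnotFamily.closed n⟩

/-- The link `J`: one of the crossings of the twisted strands of `K n` is smoothed (and the
remaining ones, which then are kinks, are removed). -/
def linkJ : OrientedLink :=
  Diagram.link ⟨KnotFamily.lower ++ [⟨.cap, 3⟩, ⟨.cup true, 3⟩] ++ KnotFamily.upper, rfl⟩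

/-!
The Conway polynomial is obtained from the vertex model of the quantum group of `gl(1|1)`. A diagram
is read as a composition of transfer operators, one for each layer, and these operators respect the
local moves (`LocalMove.sameTransfer`). Closed diagrams have state sum zero, since the quantum
dimension vanishes; so the diagram is cut open at its lowest minimum (`cutStateSum`). The result is
a scalar by Schur's lemma, in the following elementary form: the state sums are annihilated by
the odd generators (`odd_stateSum`), and the resulting linear relations are exactly what is needed
for the local moves at the bottom of the diagram, above all for an exchange of the two lowest minima
(`cutStateSum_exchange`). The weights lie in `ℤ[X][q] / (q² - X q - 1)`, in which
`q - q⁻¹ = X`. The skein relation is linear over `ℤ[X]`, so the `ℤ[X]`-linear projection to the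
coefficient of `1` again satisfies it. This yields values in `ℤ[X]` without a proof that the state
sum itself is a polynomial in `X`.

For the values, let `nabla` be any Conway polynomial. By quarter turns, the skein relation holds for
all orientations of the two strands (`skein_parallel`, `skein_antiparallel`), and a clasp of
antiparallel strands can be resolved in one step (`ofWord_clasp`). Resolving the clasps above and
below the twisted strands of `knotK 0` and of `linkJ` leaves diagrams that local moves reduce to
three short ones (`ofWord_knot_zero`, `ofWord_smoothed`). Resolving their remaining clasp
leads to unknots, unlinks, a Hopf link and a trefoil. The skein relation at a twisted crossing gives
`nabla (knotK (n + 1)) - nabla (knotK n) = X * nabla linkJ`, hence all the values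
(`nabla_knotK_eq`). The coefficient of `X ^ 2` is `2 * n`, which distinguishes the knots.
-/

namespace LinkDiagram

/-! ### The vertex model -/

section StateSum

/-- The state of a strand: its orientation (`true` for upward) and its colour. -/
abbrev Strand : Type := Bool × Bool

/-- The strand with the same orientation and the other colour. -/
def Strand.flip (x : Strand) : Strand := (x.1, !x.2)

/-- The orientations of the strands of a state. -/
def orientations (l : List Strand) : List Bool := l.map Prod.fst

variable {A : Type*} [CommRing A] (q p : A)

/-- The Boltzmann weight of a maximum that joins two strands. Here and below, `p` stands for the
inverse of `q`. -/
def capWeight : Strand → Strand → A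
  | (true, false), (false, false) => q
  | (true, true), (false, true) => -q
  | (false, false), (true, false) => 1
  | (false, true), (true, true) => 1
  | _, _ => 0

/-- The Boltzmann weight of a minimum with the given left strand; both strands have the same
colour. -/
def cupWeight : Strand → A
  | (true, _) => 1
  | (false, false) => p
  | (false, true) => -p

/-- The Boltzmann weight of a crossing at which both strands, coming from bottom left and bottom
right, keep their colours. -/
def passWeight (s : Bool) (x y : Strand) : A :=
  if x.2 = y.2 then
    if s = (x.1 == y.1) then (bif x.2 then -p else q) else (bif x.2 then -q else p)
  else 1

/-- The Boltzmann weight of a crossing at which both strands change their colours. For parallel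
strands this is possible if the colours differ, and for antiparallel strands if they agree; in
either case only for one of the two colours of the left strand. -/
def turnWeight (s : Bool) (x y : Strand) : A :=
  if (x.1 = y.1 ↔ x.2 ≠ y.2) ∧ x.2 = (s ^^ x.1) then
    bif (bif x.1 == y.1 then s else !x.2) then q - p else p - q
  else 0

/-- The transfer operator of a layer. A function on the states above the layer is pulled back to
the states below it: the value at a state is the weighted sum over the states that can
lie above it. -/
def pull : Piece → ℕ → (List Strand → A) → List Strand → A
  | .cup b, 0, f, l => cupWeight p (b, false) * f ((b, false) :: (!b, false) :: l) +
      cupWeight p (b, true) * f ((b, true) :: (!b, true) :: l)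
  | .cap, 0, f, x :: y :: l => capWeight q x y * f l
  | .cross s, 0, f, x :: y :: l => passWeight q p s x y * f (y :: x :: l) +
      turnWeight q p s x y * f (y.flip :: x.flip :: l)
  | P, i + 1, f, x :: l => pull P i (fun t => f (x :: t)) l
  | _, _, _, _ => 0

/-- The composed transfer operator of a word of layers. -/
def pullWord (w : List Layer) (f : List Strand → A) : List Strand → A :=
  w.foldr (fun x g => pull q p x.piece x.pos g) f

@[simp] lemma pullWord_nil (f : List Strand → A) : pullWord q p [] f = f := rfl

@[simp] lemma pullWord_cons (x : Layer) (w : List Layer) (f : List Strand → A) :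
    pullWord q p (x :: w) f = pull q p x.piece x.pos (pullWord q p w f) := rfl

@[simp] lemma pullWord_append (u v : List Layer) (f : List Strand → A) :
    pullWord q p (u ++ v) f = pullWord q p u (pullWord q p v f) := by
  simp [pullWord, List.foldr_append]

@[simp] lemma pull_succ_cons (P : Piece) (i : ℕ) (f : List Strand → A) (x : Strand)
    (l : List Strand) : pull q p P (i + 1) f (x :: l) = pull q p P i (fun t => f (x :: t)) l := by
  cases P <;> rfl

@[simp] lemma pull_succ_nil (P : Piece) (i : ℕ) (f : List Strand → A) :
    pull q p P (i + 1) f [] = 0 := by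
  cases P <;> rfl

lemma pull_linear (P : Piece) (i : ℕ) (a b : A) (f g : List Strand → A) (l : List Strand) :
    pull q p P i (fun t => a * f t + b * g t) l = a * pull q p P i f l + b * pull q p P i g l := by
  induction i generalizing f g l with
  | zero =>
    rcases P with b | _ | s
    · simp only [pull]; ring
    · rcases l with _ | ⟨x, _ | ⟨y, l⟩⟩ <;> simp only [pull] <;> ring
    · rcases l with _ | ⟨x, _ | ⟨y, l⟩⟩ <;> simp only [pull] <;> ring
  | succ i ih =>
    cases l with
    | nil => simp
    | cons x l => simp [ih]

lemma pull_mul (P : Piece) (i : ℕ) (a : A) (f : List Strand → A) (l : List Strand) :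
    pull q p P i (fun t => a * f t) l = a * pull q p P i f l := by
  simpa using pull_linear q p P i a 0 f f l

lemma pull_congr {P : Piece} {i : ℕ} {f g : List Strand → A} {l : List Strand} {m : List Bool}
    (h : P.act i (orientations l) = some m)
    (hfg : ∀ t, orientations t = m → f t = g t) : pull q p P i f l = pull q p P i g l := by
  induction i generalizing f g l m with
  | zero =>
    rcases P with b | _ | s
    · simp only [Piece.act, Option.some.injEq] at h
      simp only [pull]
      rw [hfg, hfg] <;> simp [orientations, ← h]
    · rcases l with _ | ⟨x, _ | ⟨y, l⟩⟩
      · rfl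
      · rfl
      · simp only [orientations, List.map_cons, Piece.act] at h
        split_ifs at h
        simp only [pull]
        rw [hfg]
        simpa [orientations] using h
    · rcases l with _ | ⟨x, _ | ⟨y, l⟩⟩
      · rfl
      · rfl
      · simp only [orientations, List.map_cons, Piece.act, Option.some.injEq] at h
        simp only [pull]
        rw [hfg, hfg] <;> simp [orientations, ← h, Strand.flip]
  | succ i ih =>
    cases l with
    | nil => simp
    | cons x l =>
      have h' : (P.act i (orientations l)).map (List.cons x.1) = some m := by
        rw [← h]; cases P <;> simp [orientations, Piece.act]
      obtain ⟨k, hk, rfl⟩ := Option.map_eq_some_iff.mp h'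
      simp only [pull_succ_cons]
      exact ih hk fun t ht => hfg _ (by simpa [orientations] using ht)

/-- A word of layers with one further vertical strand on the left. -/
def shift (w : List Layer) : List Layer := w.map fun x => ⟨x.piece, x.pos + 1⟩

lemma pullWord_shift (w : List Layer) (f : List Strand → A) (x : Strand) (l : List Strand) :
    pullWord q p (shift w) f (x :: l) = pullWord q p w (fun t => f (x :: t)) l := by
  induction w generalizing l with
  | nil => rfl
  | cons y w ih =>
    simp only [shift, List.map_cons, pullWord_cons, pull_succ_cons]
    congr 1
    funext t
    exact ih t

lemma act_succ_cons (P : Piece) (i : ℕ) (a : Bool) (l : List Bool) :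
    P.act (i + 1) (a :: l) = (P.act i l).map (List.cons a) := by
  cases P <;> rfl

lemma act_succ_nil (P : Piece) (i : ℕ) : P.act (i + 1) [] = none := by
  cases P <;> rfl

lemma run_shift (w : List Layer) (a : Bool) (l : List Bool) :
    run (shift w) (a :: l) = (run w l).map (List.cons a) := by
  induction w generalizing l with
  | nil => rfl
  | cons y w ih =>
    simp only [shift, List.map_cons, run, act_succ_cons] at ih ⊢
    cases y.piece.act y.pos l with
    | none => rfl
    | some m => exact ih m

/-- Two words of layers have the same transfer operator on all states whose orientations fit the
first word. The restriction matters if the second word is empty: the empty word fits all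
orientations, a zigzag does not. -/
def SameTransfer (l r : List Layer) : Prop :=
  ∀ (f : List Strand → A) (t : List Strand), run l (orientations t) ≠ none →
    pullWord q p l f t = pullWord q p r f t

variable {q p}

lemma SameTransfer.shift {l r : List Layer} (h : SameTransfer q p l r) (hl : l ≠ []) :
    SameTransfer q p (shift l) (shift r) := by
  intro f t ht
  cases t with
  | nil =>
    cases l with
    | nil => exact absurd rfl hl
    | cons y l =>
      simp [LinkDiagram.shift, run, orientations, act_succ_nil] at ht
  | cons x t =>
    rw [pullWord_shift, pullWord_shift]
    refine h _ _ fun h' => ht ?_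
    rw [orientations, List.map_cons, run_shift]
    simp only [orientations] at h'
    rw [h']
    rfl

lemma sameTransfer_exchange (P Q : Piece) (i k : ℕ) :
    SameTransfer q p [⟨P, i⟩, ⟨Q, i + P.outputs + k⟩] [⟨Q, i + P.inputs + k⟩, ⟨P, i⟩] := by
  induction i with
  | zero =>
    intro f t ht
    simp only [pullWord_cons, pullWord_nil]
    rcases P with b | _ | s
    · simp only [Piece.outputs, Piece.inputs, show 0 + 2 + k = k + 1 + 1 by omega,
        show 0 + 0 + k = k by omega, pull, pull_succ_cons]
      rw [pull_linear]
    · rcases t with _ | ⟨x, _ | ⟨y, t⟩⟩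
      · exact absurd rfl ht
      · exact absurd rfl ht
      · simp only [Piece.outputs, Piece.inputs, show 0 + 2 + k = k + 1 + 1 by omega,
          show 0 + 0 + k = k by omega, pull, pull_succ_cons]
        rw [pull_mul]
    · rcases t with _ | ⟨x, _ | ⟨y, t⟩⟩
      · exact absurd rfl ht
      · exact absurd rfl ht
      · simp only [Piece.outputs, Piece.inputs, show 0 + 2 + k = k + 1 + 1 by omega, pull,
          pull_succ_cons]
        rw [pull_linear]
  | succ i ih =>
    convert ih.shift (by simp) using 2 <;> simp [shift] <;> omega

lemma sameTransfer_zigzagLeft (h : q * p = 1) (b : Bool) (i : ℕ) :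
    SameTransfer q p [⟨.cup b, i⟩, ⟨.cap, i + 1⟩] [] := by
  induction i with
  | zero =>
    rintro f (_ | ⟨⟨a, c⟩, t⟩) ht
    · exact absurd rfl ht
    · cases a <;> cases b <;> simp [orientations, run, Piece.act] at ht <;> cases c <;>
        simp [pull, cupWeight, capWeight] <;> grind
  | succ i ih => exact ih.shift (by simp)

lemma sameTransfer_zigzagRight (h : q * p = 1) (b : Bool) (i : ℕ) :
    SameTransfer q p [⟨.cup b, i + 1⟩, ⟨.cap, i⟩] [] := by
  induction i with
  | zero =>
    rintro f (_ | ⟨⟨a, c⟩, t⟩) ht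
    · exact absurd rfl ht
    · cases a <;> cases b <;> simp [orientations, run, Piece.act] at ht <;> cases c <;>
        simp [pull, cupWeight, capWeight] <;> grind
  | succ i ih => exact ih.shift (by simp)

lemma sameTransfer_slideCap (s : Bool) (i : ℕ) :
    SameTransfer q p [⟨.cross s, i + 1⟩, ⟨.cap, i⟩] [⟨.cross (!s), i⟩, ⟨.cap, i + 1⟩] := by
  induction i with
  | zero =>
    rintro f (_ | ⟨⟨_ | _, _ | _⟩, _ | ⟨⟨_ | _, _ | _⟩, _ | ⟨⟨_ | _, _ | _⟩, t⟩⟩⟩) ht <;>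
      simp [orientations, run, Piece.act] at ht <;> cases s <;>
      simp [pull, capWeight, passWeight, turnWeight, Strand.flip] <;> grind
  | succ i ih => exact ih.shift (by simp)

lemma sameTransfer_slideCup (b s : Bool) (i : ℕ) :
    SameTransfer q p [⟨.cup b, i⟩, ⟨.cross s, i + 1⟩] [⟨.cup b, i + 1⟩, ⟨.cross (!s), i⟩] := by
  induction i with
  | zero =>
    rintro f (_ | ⟨⟨_ | _, _ | _⟩, t⟩) ht <;>
      simp [orientations, run, Piece.act] at ht <;> cases b <;> cases s <;>
      simp [pull, cupWeight, passWeight, turnWeight, Strand.flip] <;> grind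
  | succ i ih => exact ih.shift (by simp)

lemma sameTransfer_reidemeisterOneCup (h : q * p = 1) (b s : Bool) (i : ℕ) :
    SameTransfer q p [⟨.cup b, i⟩, ⟨.cross s, i⟩] [⟨.cup (!b), i⟩] := by
  induction i with
  | zero =>
    intro f t _
    cases b <;> cases s <;>
      simp [pull, cupWeight, passWeight, turnWeight, Strand.flip] <;> grind
  | succ i ih => exact ih.shift (by simp)

lemma sameTransfer_reidemeisterOneCap (h : q * p = 1) (s : Bool) (i : ℕ) :
    SameTransfer q p [⟨.cross s, i⟩, ⟨.cap, i⟩] [⟨.cap, i⟩] := by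
  induction i with
  | zero =>
    rintro f (_ | ⟨⟨_ | _, _ | _⟩, _ | ⟨⟨_ | _, _ | _⟩, t⟩⟩) ht <;>
      simp [orientations, run, Piece.act] at ht <;> cases s <;>
      simp [pull, capWeight, passWeight, turnWeight, Strand.flip] <;> grind
  | succ i ih => exact ih.shift (by simp)

/-- The transfer operator of a crossing of the first two of three strands. -/
def crossLeft (q p : A) (s : Bool) (f : Strand → Strand → Strand → A) (x y z : Strand) : A :=
  passWeight q p s x y * f y x z + turnWeight q p s x y * f y.flip x.flip z

/-- The transfer operator of a crossing of the last two of three strands. -/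
def crossRight (q p : A) (s : Bool) (f : Strand → Strand → Strand → A) (x y z : Strand) : A :=
  passWeight q p s y z * f x z y + turnWeight q p s y z * f x z.flip y.flip

lemma crossLeft_crossLeft (h : q * p = 1) (s : Bool) (f : Strand → Strand → Strand → A) :
    crossLeft q p s (crossLeft q p (!s) f) = f := by
  funext x y z
  obtain ⟨_ | _, _ | _⟩ := x <;> obtain ⟨_ | _, _ | _⟩ := y <;> cases s <;>
    simp [crossLeft, passWeight, turnWeight, Strand.flip] <;> grind

lemma crossRight_crossRight (h : q * p = 1) (s : Bool) (f : Strand → Strand → Strand → A) :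
    crossRight q p s (crossRight q p (!s) f) = f := by
  funext x y z
  exact congrFun (congrFun (congrFun (crossLeft_crossLeft h s fun y z _ => f x y z) y) z) x

set_option maxHeartbeats 4000000 in
lemma crossLeft_crossRight_crossLeft (h : q * p = 1) (f : Strand → Strand → Strand → A) :
    crossLeft q p true (crossRight q p true (crossLeft q p true f)) =
      crossRight q p true (crossLeft q p true (crossRight q p true f)) := by
  funext x y z
  obtain ⟨_ | _, _ | _⟩ := x <;> obtain ⟨_ | _, _ | _⟩ := y <;> obtain ⟨_ | _, _ | _⟩ := z <;>
    simp [crossLeft, crossRight, passWeight, turnWeight, Strand.flip] <;> grind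

/-- In a group, the braid relation implies its variants with signs. -/
lemma braid_relation_signs {G : Type*} [Group G] {x y : G} (h : x * y * x = y * x * y)
    (s t r : Bool) (hs : s = t ∨ t = r) :
    (bif s then x else x⁻¹) * (bif t then y else y⁻¹) * (bif r then x else x⁻¹) =
      (bif r then y else y⁻¹) * (bif t then x else x⁻¹) * (bif s then y else y⁻¹) := by
  have h1 : x * y * x⁻¹ = y⁻¹ * x * y := by
    rw [mul_inv_eq_iff_eq_mul, mul_assoc, mul_assoc, eq_inv_mul_iff_mul_eq, ← mul_assoc,
      ← mul_assoc, h]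
  have h2 : y * x * y⁻¹ = x⁻¹ * y * x := by
    rw [mul_inv_eq_iff_eq_mul, mul_assoc, mul_assoc, eq_inv_mul_iff_mul_eq, ← mul_assoc,
      ← mul_assoc, h]
  have h0 : x⁻¹ * y⁻¹ * x⁻¹ = y⁻¹ * x⁻¹ * y⁻¹ := by
    simpa [mul_assoc] using congrArg (·⁻¹) h
  have h3 : x * y⁻¹ * x⁻¹ = y⁻¹ * x⁻¹ * y := by
    simpa [mul_assoc] using congrArg (·⁻¹) h1
  have h4 : y * x⁻¹ * y⁻¹ = x⁻¹ * y⁻¹ * x := by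
    simpa [mul_assoc] using congrArg (·⁻¹) h2
  cases s <;> cases t <;> cases r <;> simp_all

/-- All variants of the third Reidemeister move follow from the one with three equal crossings, as
the transfer operators of the two signs are inverse to each other. -/
lemma crossLeft_crossRight_crossLeft_signs (h : q * p = 1) (s t r : Bool) (hs : s = t ∨ t = r)
    (f : Strand → Strand → Strand → A) :
    crossLeft q p s (crossRight q p t (crossLeft q p r f)) =
      crossRight q p r (crossLeft q p t (crossRight q p s f)) := by
  let u : Equiv.Perm (Strand → Strand → Strand → A) :=
    ⟨crossLeft q p true, crossLeft q p false, crossLeft_crossLeft h false,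
      crossLeft_crossLeft h true⟩
  let v : Equiv.Perm (Strand → Strand → Strand → A) :=
    ⟨crossRight q p true, crossRight q p false, crossRight_crossRight h false,
      crossRight_crossRight h true⟩
  have huv : u * v * u = v * u * v := Equiv.ext (crossLeft_crossRight_crossLeft h)
  have := congrFun (congrArg DFunLike.coe (braid_relation_signs huv s t r hs)) f
  cases s <;> cases t <;> cases r <;> exact this

lemma sameTransfer_reidemeisterTwo (h : q * p = 1) (s : Bool) (i : ℕ) :
    SameTransfer q p [⟨.cross s, i⟩, ⟨.cross (!s), i⟩] [] := by
  induction i with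
  | zero =>
    rintro f (_ | ⟨x, _ | ⟨y, t⟩⟩) ht
    · exact absurd rfl ht
    · exact absurd rfl ht
    · exact congrFun (congrFun (congrFun
        (crossLeft_crossLeft h s fun x y _ => f (x :: y :: t)) x) y) x
  | succ i ih => exact ih.shift (by simp)

lemma sameTransfer_reidemeisterThree (h : q * p = 1) (s t r : Bool) (i : ℕ)
    (hs : s = t ∨ t = r) :
    SameTransfer q p [⟨.cross s, i⟩, ⟨.cross t, i + 1⟩, ⟨.cross r, i⟩]
        [⟨.cross r, i + 1⟩, ⟨.cross t, i⟩, ⟨.cross s, i + 1⟩] := by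
  induction i with
  | zero =>
    rintro f (_ | ⟨x, _ | ⟨y, _ | ⟨z, l⟩⟩⟩) hl
    · exact absurd rfl hl
    · exact absurd rfl hl
    · exact absurd rfl hl
    · exact congrFun (congrFun (congrFun (crossLeft_crossRight_crossLeft_signs h s t r hs
        fun x y z => f (x :: y :: z :: l)) x) y) z
  | succ i ih => exact ih.shift (by simp)

lemma LocalMove.sameTransfer (h : q * p = 1) {l r : List Layer} (hm : LocalMove l r) :
    SameTransfer q p l r := by
  cases hm with
  | exchange P Q i k => exact sameTransfer_exchange P Q i k
  | zigzagLeft b i => exact sameTransfer_zigzagLeft h b i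
  | zigzagRight b i => exact sameTransfer_zigzagRight h b i
  | slideCap s i => exact sameTransfer_slideCap s i
  | slideCup b s i => exact sameTransfer_slideCup b s i
  | reidemeisterOneCup b s i => exact sameTransfer_reidemeisterOneCup h b s i
  | reidemeisterOneCap s i => exact sameTransfer_reidemeisterOneCap h s i
  | reidemeisterTwo s i => exact sameTransfer_reidemeisterTwo h s i
  | reidemeisterThree s t r i hs => exact sameTransfer_reidemeisterThree h s t r i hs

end StateSum

/-! ### Cutting a diagram open -/

section Invariance

variable {A : Type*} [CommRing A] {q p : A}

lemma SameTransfer.append {l r : List Layer} (h : SameTransfer q p l r) (u v : List Layer) :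
    SameTransfer q p (u ++ l ++ v) (u ++ r ++ v) := by
  intro f t ht
  induction u generalizing t with
  | nil =>
    simp only [List.nil_append, pullWord_append] at ht ⊢
    refine h _ _ fun h' => ht ?_
    rw [KnotFamily.run_append, h']
    rfl
  | cons x u ih =>
    simp only [List.cons_append, pullWord_cons, run] at ht ⊢
    cases hx : x.piece.act x.pos (orientations t) with
    | none => simp [hx] at ht
    | some m =>
      refine pull_congr q p hx fun s hs => ih s ?_
      simpa [hx, hs] using ht

variable (q p)

/-- The factor that a strand contributes if it lies to the left of the strand on which an odd
generator acts. -/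
def leftWeight : Strand → A
  | (true, false) => q
  | (true, true) => -q
  | (false, false) => p
  | (false, true) => -p

/-- The matrix entry of an odd generator on one strand, from `x` to `x.flip`. The sign `r` selects
one of the two generators; they change the colours of upward strands in opposite directions. -/
def oddWeight (r : Bool) (x : Strand) : A :=
  bif x.2 == (x.1 == r) then bif x.1 then 1 else -leftWeight q p x else 0

/-- The action of the odd generators of the quantum group of `gl(1|1)` on functions on states: one
strand changes its colour, and the strands on its left contribute a factor. -/
def odd (r : Bool) (f : List Strand → A) : List Strand → A
  | [] => 0
  | x :: l => oddWeight q p r x * f (x.flip :: l) +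
      leftWeight q p x * odd r (fun t => f (x :: t)) l

lemma odd_linear (r : Bool) (a b : A) (f g : List Strand → A) (l : List Strand) :
    odd q p r (fun t => a * f t + b * g t) l = a * odd q p r f l + b * odd q p r g l := by
  induction l generalizing f g with
  | nil => simp [odd]
  | cons x l ih => simp only [odd, ih]; ring

lemma odd_mul (r : Bool) (a : A) (f : List Strand → A) (l : List Strand) :
    odd q p r (fun t => a * f t) l = a * odd q p r f l := by
  simpa using odd_linear q p r a 0 f f l

lemma odd_zero (r : Bool) : odd q p r (fun _ => 0) = fun _ => 0 := by
  funext l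
  simpa using odd_mul q p r 0 (fun _ => 0) l

variable {q p}

/-- The transfer operators commute with the odd generators. -/
lemma pull_odd (h : q * p = 1) (r : Bool) (P : Piece) (i : ℕ) (f : List Strand → A)
    (l : List Strand) : pull q p P i (odd q p r f) l = odd q p r (pull q p P i f) l := by
  induction i generalizing f l with
  | zero =>
    rcases P with b | _ | s
    · simp only [pull]
      rw [odd_linear]
      cases b <;> cases r <;> simp [odd, cupWeight, oddWeight, leftWeight, Strand.flip] <;> grind
    · rcases l with _ | ⟨⟨_ | _, _ | _⟩, _ | ⟨⟨_ | _, _ | _⟩, l⟩⟩ <;>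
        simp only [pull, odd, odd_mul, Strand.flip] <;> cases r <;>
        simp [capWeight, oddWeight, leftWeight] <;> grind
    · rcases l with _ | ⟨⟨_ | _, _ | _⟩, _ | ⟨⟨_ | _, _ | _⟩, l⟩⟩ <;>
        simp only [pull, odd, odd_linear, Strand.flip, Bool.not_true, Bool.not_false] <;>
        cases s <;> cases r <;>
        simp [passWeight, turnWeight, oddWeight, leftWeight] <;> grind
  | succ i ih =>
    cases l with
    | nil => simp [odd]
    | cons x l => simp only [pull_succ_cons, odd, pull_linear, ih]

variable (q p)

/-- The state sum of a word of layers whose top is empty, as a function of the state at the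
bottom. -/
def stateSum (w : List Layer) : List Strand → A :=
  pullWord q p w fun t => if t = [] then 1 else 0

variable {q p}

lemma odd_stateSum (h : q * p = 1) (r : Bool) (w : List Layer) (l : List Strand) :
    odd q p r (stateSum q p w) l = 0 := by
  suffices odd q p r (stateSum q p w) = fun _ => 0 from congrFun this l
  clear l
  induction w with
  | nil =>
    funext l
    cases l <;> simp [stateSum, odd, odd_zero]
  | cons x w ih =>
    funext l
    change odd q p r (pull q p x.piece x.pos (stateSum q p w)) l = 0
    rw [← pull_odd h, ih]
    simpa using pull_mul q p x.piece x.pos 0 (fun _ => (0 : A)) l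

variable (q p)

/-- The state sum of a diagram that is cut open at its lowest minimum. The two ends have the
colour `false`, and the value is divided by the weight `q` or `1` of the maximum with these ends,
so that the unknot has the value `1`. -/
def cutStateSum : List Layer → A
  | ⟨.cup true, _⟩ :: w => p * stateSum q p w [(true, false), (false, false)]
  | ⟨.cup false, _⟩ :: w => stateSum q p w [(false, false), (true, false)]
  | _ => 0

variable {q p}

/-- The orientation of the circle that is cut open may be reversed by a kink. -/
lemma cutStateSum_reidemeisterOneCup (h : q * p = 1) (b s : Bool) (i j : ℕ) (v : List Layer) :
    cutStateSum q p (⟨.cup b, i⟩ :: ⟨.cross s, 0⟩ :: v) =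
      cutStateSum q p (⟨.cup (!b), j⟩ :: v) := by
  have h1 := odd_stateSum h false v [(true, false), (false, true)]
  have h2 := odd_stateSum h false v [(false, true), (true, false)]
  cases b <;> cases s <;>
    simp [odd, cutStateSum, stateSum, pull, passWeight, turnWeight, oddWeight, leftWeight,
      Strand.flip] at h1 h2 ⊢ <;>
    grind

/-- The cut may be made at either of the two lowest minima. -/
lemma cutStateSum_exchange (h : q * p = 1) (b c : Bool) (v : List Layer) :
    cutStateSum q p (⟨.cup b, 0⟩ :: ⟨.cup c, 2⟩ :: v) =
      cutStateSum q p (⟨.cup c, 0⟩ :: ⟨.cup b, 0⟩ :: v) := by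
  -- These are the states to which the odd generators assign relations between the values of the
  -- state sum that occur on both sides.
  have H1 (r k : Bool) := odd_stateSum h r v [(b, b == r), (!b, b ^^ r), (c, k), (!c, k)]
  have H2 (r k : Bool) := odd_stateSum h r v [(b, k), (!b, k), (c, c == r), (!c, c ^^ r)]
  have h1 := H1 false false
  have h2 := H1 false true
  have h3 := H1 true false
  have h4 := H1 true true
  have h5 := H2 false false
  have h6 := H2 false true
  have h7 := H2 true false
  have h8 := H2 true true
  clear H1 H2
  cases b <;> cases c <;>
    simp [odd, cutStateSum, stateSum, pull, cupWeight, oddWeight, leftWeight, Strand.flip]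
      at h1 h2 h3 h4 h5 h6 h7 h8 ⊢ <;>
    grind

/-- The lowest layer of a diagram is a minimum. -/
lemma eq_cup_of_run {x : Layer} {w : List Layer} (h : run (x :: w) [] = some []) :
    ∃ b, x = ⟨.cup b, 0⟩ ∧ run w [b, !b] = some [] := by
  obtain ⟨b | _ | s, _ | i⟩ := x <;> simp [run, Piece.act] at h
  exact ⟨b, rfl, h⟩

lemma cutStateSum_eq_of_localMove (h : q * p = 1) {u l r v : List Layer} (hm : LocalMove l r)
    (hl : run (u ++ l ++ v) [] = some []) (hr : run (u ++ r ++ v) [] = some []) :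
    cutStateSum q p (u ++ l ++ v) = cutStateSum q p (u ++ r ++ v) := by
  cases u with
  | nil =>
    cases hm with
    | exchange P Q i k =>
      obtain ⟨b, hb, -⟩ := eq_cup_of_run hl
      obtain ⟨c, hc, -⟩ := eq_cup_of_run hr
      obtain ⟨rfl, rfl⟩ := Layer.mk.inj hb
      obtain ⟨rfl, hk⟩ := Layer.mk.inj hc
      obtain rfl : k = 0 := by omega
      exact cutStateSum_exchange h b c v
    | reidemeisterOneCup b s i =>
      obtain ⟨c, hc, -⟩ := eq_cup_of_run hl
      obtain ⟨-, rfl⟩ := Layer.mk.inj hc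
      exact cutStateSum_reidemeisterOneCup h b s 0 0 v
    | zigzagLeft b i =>
      obtain ⟨c, hc, hw⟩ := eq_cup_of_run hl
      obtain ⟨-, rfl⟩ := Layer.mk.inj hc
      simp [run, Piece.act] at hw
    | slideCup b s i =>
      obtain ⟨c, hc, hw⟩ := eq_cup_of_run hr
      simp at hc
    | zigzagRight | slideCap | reidemeisterOneCap | reidemeisterTwo | reidemeisterThree =>
      obtain ⟨c, hc, hw⟩ := eq_cup_of_run hl
      simp at hc
  | cons x u =>
    obtain ⟨b, rfl, hw⟩ := eq_cup_of_run hl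
    have key := (hm.sameTransfer h).append u v (fun t => if t = [] then 1 else 0)
    cases b
    · exact key _ fun e => by simpa using hw.symm.trans e
    · exact congrArg (p * ·) (key _ fun e => by simpa using hw.symm.trans e)

lemma pull_cross_sub (i : ℕ) (f : List Strand → A) (t : List Strand)
    (h0 : (orientations t)[i]? = some true) (h1 : (orientations t)[i + 1]? = some true) :
    pull q p (.cross true) i f t - pull q p (.cross false) i f t = (q - p) * f t := by
  induction i generalizing f t with
  | zero =>
    rcases t with _ | ⟨⟨a, c⟩, _ | ⟨⟨b, d⟩, t⟩⟩
    · simp [orientations] at h0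
    · simp [orientations] at h1
    · simp [orientations] at h0 h1
      subst h0 h1
      cases c <;> cases d <;> simp [pull, passWeight, turnWeight, Strand.flip] <;> grind
  | succ i ih =>
    cases t with
    | nil => simp [orientations] at h0
    | cons x t =>
      simp only [pull_succ_cons]
      exact ih _ t (by simpa [orientations] using h0) (by simpa [orientations] using h1)

lemma stateSum_skein {u : List Layer} (v : List Layer) (i : ℕ) {l : List Bool}
    {t : List Strand} (hu : run u (orientations t) = some l) (h0 : l[i]? = some true)
    (h1 : l[i + 1]? = some true) :
    stateSum q p (u ++ [⟨.cross true, i⟩] ++ v) t - stateSum q p (u ++ [⟨.cross false, i⟩] ++ v) t =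
      (q - p) * stateSum q p (u ++ v) t := by
  induction u generalizing t with
  | nil =>
    obtain rfl : orientations t = l := by simpa [run] using hu
    exact pull_cross_sub i (stateSum q p v) t h0 h1
  | cons x u ih =>
    simp only [run] at hu
    cases hx : x.piece.act x.pos (orientations t) with
    | none => simp [hx] at hu
    | some m =>
      simp only [hx, Option.bind_some] at hu
      change pull q p x.piece x.pos (stateSum q p _) t - pull q p x.piece x.pos (stateSum q p _) t =
        (q - p) * pull q p x.piece x.pos (stateSum q p _) t
      rw [← pull_mul, sub_eq_iff_eq_add]
      have key := pull_linear q p x.piece x.pos 1 1 (fun t => (q - p) * stateSum q p (u ++ v) t)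
        (stateSum q p (u ++ [⟨.cross false, i⟩] ++ v)) t
      simp only [one_mul] at key
      refine Eq.trans ?_ key
      refine pull_congr q p hx fun s hs => ?_
      rw [← sub_eq_iff_eq_add]
      exact ih (by rw [hs]; exact hu)

lemma cutStateSum_skein {u : List Layer} (v : List Layer) (i : ℕ) {l : List Bool}
    (hu : run u [] = some l) (h0 : l[i]? = some true) (h1 : l[i + 1]? = some true) :
    cutStateSum q p (u ++ [⟨.cross true, i⟩] ++ v) -
        cutStateSum q p (u ++ [⟨.cross false, i⟩] ++ v) =
      (q - p) * cutStateSum q p (u ++ v) := by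
  rcases u with _ | ⟨⟨b | _ | s, _ | j⟩, u⟩
  · obtain rfl : [] = l := by simpa [run] using hu
    simp at h0
  · simp only [run, Piece.act, Option.bind_some] at hu
    cases b
    · exact stateSum_skein (q := q) (p := p) v i (t := [(false, false), (true, false)]) hu h0 h1
    · have := stateSum_skein (q := q) (p := p) v i (t := [(true, false), (false, false)]) hu h0 h1
      simp only [List.cons_append, cutStateSum]
      rw [← mul_sub, this]
      ring
  all_goals simp [run, Piece.act] at hu

end Invariance

/-- The Conway polynomial exists: it is the coefficient of `1` of the cut state sum in the basis
`1, q` over `ℤ[X]`. -/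
theorem exists_isConwayPolynomial : ∃ nabla : OrientedLink → ℤ[X], IsConwayPolynomial nabla := by
  -- `q` is the root adjoined to `ℤ[X]`, and `p` is its inverse `q - X`.
  let q : QuadraticAlgebra ℤ[X] 1 X := ⟨0, 1⟩
  let p : QuadraticAlgebra ℤ[X] 1 X := ⟨-X, 1⟩
  have h : q * p = 1 := by
    ext1
    · simp [q, p, QuadraticAlgebra.re_one]
    · simp [q, p, QuadraticAlgebra.im_one]
  refine ⟨Quot.lift (fun D => (cutStateSum q p D.word).re) ?_, ?_, ?_⟩
  · rintro ⟨_, hD⟩ ⟨_, hE⟩ ⟨u, l, r, v, hm, rfl, rfl⟩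
    exact congrArg QuadraticAlgebra.re (cutStateSum_eq_of_localMove h hm hD hE)
  · change (p * (q * 1)).re = 1
    rw [mul_one, mul_comm, h, QuadraticAlgebra.re_one]
  · rintro _ _ _ ⟨⟨_, _⟩, ⟨_, _⟩, ⟨_, _⟩, u, v, i, l, rfl, rfl, rfl, hu, h0, h1, rfl, rfl, rfl⟩
    have := congrArg QuadraticAlgebra.re (cutStateSum_skein (q := q) (p := p) v i hu h0 h1)
    rw [show q - p = ⟨X, 0⟩ by simp [q, p]] at this
    simp only [QuadraticAlgebra.re_sub, QuadraticAlgebra.re_mul, mul_zero, zero_mul,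
      add_zero] at this
    exact this

/-! ### The skein relation for all orientations -/

section Skein

/-- A word of layers with `n` further vertical strands on the left. -/
def shiftBy (n : ℕ) (w : List Layer) : List Layer := w.map fun x => ⟨x.piece, n + x.pos⟩

lemma act_append (P : Piece) (k : ℕ) (a m : List Bool) :
    P.act (a.length + k) (a ++ m) = (P.act k m).map (a ++ ·) := by
  induction a with
  | nil => simp
  | cons b a ih =>
    rw [List.length_cons, Nat.add_right_comm, List.cons_append, act_succ_cons, ih, Option.map_map]
    rfl

lemma run_shiftBy (w : List Layer) (a m : List Bool) :
    run (shiftBy a.length w) (a ++ m) = (run w m).map (a ++ ·) := by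
  induction w generalizing m with
  | nil => rfl
  | cons x w ih =>
    simp only [shiftBy, List.map_cons, run, act_append] at ih ⊢
    cases x.piece.act x.pos m with
    | none => rfl
    | some m' => exact ih m'

lemma run_append_shiftBy {u : List Layer} {a m m' : List Bool} (w : List Layer)
    (hu : run u [] = some (a ++ m)) (hw : run w m = some m') :
    run (u ++ shiftBy a.length w) [] = some (a ++ m') := by
  rw [KnotFamily.run_append, hu, Option.bind_some, run_shiftBy, hw]
  rfl

lemma run_append_append {u v : List Layer} {l : List Bool} (hu : run u [] = some l)
    (hv : run v l = some []) : run (u ++ v) [] = some [] := by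
  rw [KnotFamily.run_append, hu, Option.bind_some, hv]

/-- A function on oriented links, as a function on words of layers; it vanishes on the words that
are not diagrams. -/
noncomputable def ofWord (nabla : OrientedLink → ℤ[X]) (w : List Layer) : ℤ[X] :=
  if h : run w [] = some [] then nabla (Diagram.link ⟨w, h⟩) else 0

variable {nabla : OrientedLink → ℤ[X]}

lemma nabla_link (D : Diagram) : nabla D.link = ofWord nabla D.word := by
  rw [ofWord, dif_pos D.closed]

/-- Invariance under a local move, if the words are closed up to the same state of orientations. -/
lemma ofWord_append_move {l r : List Layer} (hm : LocalMove l r) {u v : List Layer}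
    (hl : run (u ++ l ++ v) [] = some []) (hr : run (u ++ r ++ v) [] = some []) :
    ofWord nabla (u ++ l ++ v) = ofWord nabla (u ++ r ++ v) := by
  rw [ofWord, ofWord, dif_pos hl, dif_pos hr]
  exact congrArg nabla (Quot.sound ⟨u, l, r, v, hm, rfl, rfl⟩)

/-- Invariance under a local move on the part of a word that begins after `n` layers. -/
lemma ofWord_move {w w' l r : List Layer} (n : ℕ) (hm : LocalMove l r)
    (hw : w.take n ++ l ++ w.drop (n + l.length) = w := by rfl)
    (hw' : w.take n ++ r ++ w.drop (n + l.length) = w' := by rfl)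
    (h : run w [] = some [] := by rfl) (h' : run w' [] = some [] := by rfl) :
    ofWord nabla w = ofWord nabla w' := by
  subst hw'
  have key := ofWord_append_move (nabla := nabla) hm (hw.symm ▸ h) h'
  rwa [hw] at key

/-- A local move inside the word above `u`. The orientations below and above the
changed part are `a ++ m` and `a ++ m'`. -/
lemma ofWord_move_at {u v l r : List Layer} {a m m' : List Bool}
    (hm : LocalMove (shiftBy a.length l) (shiftBy a.length r))
    (hu : run u [] = some (a ++ m)) (hv : run v (a ++ m') = some [])
    (hl : run l m = some m') (hr : run r m = some m') :
    ofWord nabla (u ++ shiftBy a.length l ++ v) = ofWord nabla (u ++ shiftBy a.length r ++ v) :=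
  ofWord_append_move hm (run_append_append (run_append_shiftBy l hu hl) hv)
    (run_append_append (run_append_shiftBy r hu hr) hv)

/-- A crossing is rotated by a quarter turn: one of its strands is bent back on either side. -/
lemma ofWord_rotate {u v : List Layer} {a b : List Bool} {x y : Bool} (s : Bool)
    (hu : run u [] = some (a ++ x :: y :: b)) (hv : run v (a ++ y :: x :: b) = some []) :
    ofWord nabla (u ++ [⟨.cross s, a.length⟩] ++ v) =
      ofWord nabla (u ++ [⟨.cup y, a.length⟩] ++ [⟨.cross (!s), a.length + 1⟩] ++
        (⟨.cap, a.length + 2⟩ :: v)) := by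
  have hu1 : run (u ++ [⟨.cross s, a.length⟩]) [] = some (a ++ y :: x :: b) :=
    run_append_shiftBy [⟨.cross s, 0⟩] hu rfl
  have hu2 : run (u ++ [⟨.cup y, a.length⟩]) [] = some (a ++ y :: (!y) :: x :: y :: b) :=
    run_append_shiftBy [⟨.cup y, 0⟩] hu rfl
  have hv1 : run (⟨.cap, a.length + 1⟩ :: v) (a ++ y :: (!y) :: y :: x :: b) = some [] := by
    have := run_shiftBy [⟨.cap, 1⟩] a (y :: (!y) :: y :: x :: b)
    rw [show run [⟨.cap, 1⟩] (y :: (!y) :: y :: x :: b) = some (y :: x :: b) by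
      simp [run, Piece.act]] at this
    change run (shiftBy a.length [⟨.cap, 1⟩] ++ v) _ = _
    rw [KnotFamily.run_append, this]
    exact hv
  have e1 := ofWord_move_at (nabla := nabla) (l := [⟨.cup y, 0⟩, ⟨.cap, 1⟩]) (r := [])
    (.zigzagLeft y a.length) hu1 hv (by simp [run, Piece.act]) rfl
  have e2 := ofWord_move_at (nabla := nabla) (l := [⟨.cup y, 0⟩, ⟨.cross s, 2⟩])
    (r := [⟨.cross s, 0⟩, ⟨.cup y, 0⟩]) (.exchange (.cup y) (.cross s) a.length 0) hu hv1 rfl rfl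
  have e3 := ofWord_move_at (nabla := nabla) (l := [⟨.cross s, 2⟩, ⟨.cap, 1⟩])
    (r := [⟨.cross (!s), 1⟩, ⟨.cap, 2⟩]) (.slideCap s (a.length + 1)) hu2 hv
    (by simp [run, Piece.act]) (by simp [run, Piece.act])
  simp only [shiftBy, List.map_cons, List.map_nil, List.append_assoc, List.cons_append,
    List.nil_append, List.append_nil, Nat.add_zero] at e1 e2 e3 ⊢
  rw [← e1, ← e2, e3]

/-- The skein relation at a crossing of two upward strands. -/
lemma skein_up (hn : IsConwayPolynomial nabla) {u v : List Layer} {a b : List Bool}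
    (hu : run u [] = some (a ++ true :: true :: b))
    (hv : run v (a ++ true :: true :: b) = some []) :
    ofWord nabla (u ++ [⟨.cross true, a.length⟩] ++ v) -
        ofWord nabla (u ++ [⟨.cross false, a.length⟩] ++ v) = X * ofWord nabla (u ++ v) := by
  have h (s : Bool) : run (u ++ [⟨.cross s, a.length⟩] ++ v) [] = some [] :=
    run_append_append (run_append_shiftBy [⟨.cross s, 0⟩] hu rfl) hv
  have h0 := run_append_append hu hv
  have := hn.2 _ _ _ ⟨⟨_, h true⟩, ⟨_, h false⟩, ⟨_, h0⟩, u, v, a.length, _, rfl, rfl, rfl, hu,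
    by simp, by simp, rfl, rfl, rfl⟩
  simpa only [nabla_link] using this

/-- The skein relation at a crossing of two antiparallel strands follows from that at a crossing of
parallel ones, by a quarter turn. -/
lemma skein_antiparallel_of_parallel {u v : List Layer} {a b : List Bool} {x : Bool}
    (hx : ∀ {u v : List Layer} {a b : List Bool}, run u [] = some (a ++ x :: x :: b) →
      run v (a ++ x :: x :: b) = some [] →
      ofWord nabla (u ++ [⟨.cross true, a.length⟩] ++ v) -
        ofWord nabla (u ++ [⟨.cross false, a.length⟩] ++ v) = X * ofWord nabla (u ++ v))
    (hu : run u [] = some (a ++ x :: (!x) :: b)) (hv : run v (a ++ (!x) :: x :: b) = some []) :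
    ofWord nabla (u ++ [⟨.cross false, a.length⟩] ++ v) -
        ofWord nabla (u ++ [⟨.cross true, a.length⟩] ++ v) =
      X * ofWord nabla (u ++ [⟨.cap, a.length⟩, ⟨.cup (!x), a.length⟩] ++ v) := by
  have hu2 : run (u ++ [⟨.cup (!x), a.length⟩]) [] =
      some ((a ++ [!x]) ++ x :: x :: (!x) :: b) := by
    have := run_append_shiftBy [⟨.cup (!x), 0⟩] hu rfl
    simpa [shiftBy] using this
  have hv2 : run (⟨.cap, a.length + 2⟩ :: v) ((a ++ [!x]) ++ x :: x :: (!x) :: b) = some [] := by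
    have := run_shiftBy [⟨.cap, 2⟩] a ((!x) :: x :: x :: (!x) :: b)
    rw [show run [⟨.cap, 2⟩] ((!x) :: x :: x :: (!x) :: b) = some ((!x) :: x :: b) by
      simp [run, Piece.act]] at this
    rw [List.append_assoc]
    change run (shiftBy a.length [⟨.cap, 2⟩] ++ v) _ = _
    rw [KnotFamily.run_append]
    exact this ▸ hv
  have key := hx hu2 hv2
  have e := ofWord_move_at (nabla := nabla) (l := [⟨.cup (!x), 0⟩, ⟨.cap, 2⟩])
    (r := [⟨.cap, 0⟩, ⟨.cup (!x), 0⟩]) (.exchange (.cup (!x)) .cap a.length 0) hu hv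
    (by simp [run, Piece.act]) (by simp [run, Piece.act])
  rw [ofWord_rotate false hu hv, ofWord_rotate true hu hv]
  simp only [shiftBy, List.map_cons, List.map_nil, List.append_assoc, List.cons_append,
    List.nil_append, Nat.add_zero, List.length_append, List.length_cons, List.length_nil,
    Nat.zero_add, Bool.not_true, Bool.not_false] at key e ⊢
  rw [key, e]

/-- The skein relation at a crossing of two parallel strands. -/
lemma skein_parallel (hn : IsConwayPolynomial nabla) {u v : List Layer} {a b : List Bool} {x : Bool}
    (hu : run u [] = some (a ++ x :: x :: b)) (hv : run v (a ++ x :: x :: b) = some []) :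
    ofWord nabla (u ++ [⟨.cross true, a.length⟩] ++ v) -
        ofWord nabla (u ++ [⟨.cross false, a.length⟩] ++ v) = X * ofWord nabla (u ++ v) := by
  cases x with
  | true => exact skein_up hn hu hv
  | false =>
    have hu2 : run (u ++ [⟨.cup false, a.length⟩]) [] =
        some ((a ++ [false]) ++ true :: (!true) :: false :: b) := by
      have := run_append_shiftBy [⟨.cup false, 0⟩] hu rfl
      simpa [shiftBy] using this
    have hv2 : run (⟨.cap, a.length + 2⟩ :: v) ((a ++ [false]) ++ (!true) :: true :: false :: b) =
        some [] := by
      have := run_shiftBy [⟨.cap, 2⟩] a (false :: false :: true :: false :: b)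
      rw [List.append_assoc]
      change run (shiftBy a.length [⟨.cap, 2⟩] ++ v) _ = _
      rw [KnotFamily.run_append]
      exact this ▸ hv
    have key := skein_antiparallel_of_parallel (skein_up hn) hu2 hv2
    have hu3 : run (u ++ [⟨.cup false, a.length⟩, ⟨.cap, a.length + 1⟩]) [] =
        some (a ++ false :: false :: b) :=
      run_append_shiftBy [⟨.cup false, 0⟩, ⟨.cap, 1⟩] hu rfl
    have e1 := ofWord_move_at (nabla := nabla) (l := [⟨.cup false, 0⟩, ⟨.cap, 1⟩]) (r := [])
      (.zigzagLeft false a.length) hu hv rfl rfl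
    have e2 := ofWord_move_at (nabla := nabla) (a := a ++ [false])
      (l := [⟨.cup false, 0⟩, ⟨.cap, 1⟩]) (r := []) (.zigzagLeft false _)
      (u := u ++ [⟨.cup false, a.length⟩, ⟨.cap, a.length + 1⟩]) (v := v) (m := false :: b)
      (by simpa using hu3) (by simpa using hv) rfl rfl
    rw [ofWord_rotate false hu hv, ofWord_rotate true hu hv]
    simp only [shiftBy, List.map_cons, List.map_nil, List.append_assoc, List.cons_append,
      List.nil_append, Nat.add_zero, List.length_append, List.length_cons, List.length_nil,
      Nat.zero_add, Bool.not_true, Bool.not_false] at key e1 e2 ⊢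
    rw [key, e2, e1]

/-- The skein relation at a crossing of two antiparallel strands. -/
lemma skein_antiparallel (hn : IsConwayPolynomial nabla) {u v : List Layer} {a b : List Bool}
    {x : Bool} (hu : run u [] = some (a ++ x :: (!x) :: b))
    (hv : run v (a ++ (!x) :: x :: b) = some []) :
    ofWord nabla (u ++ [⟨.cross false, a.length⟩] ++ v) -
        ofWord nabla (u ++ [⟨.cross true, a.length⟩] ++ v) =
      X * ofWord nabla (u ++ [⟨.cap, a.length⟩, ⟨.cup (!x), a.length⟩] ++ v) :=
  skein_antiparallel_of_parallel (skein_parallel hn) hu hv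

end Skein

/-! ### Clasps and split circles -/

section SkeinConsequences

variable {nabla : OrientedLink → ℤ[X]}

/-- A clasp of two antiparallel strands can be opened, at the cost of a term in which it is replaced
by a maximum and a minimum. -/
lemma ofWord_clasp (hn : IsConwayPolynomial nabla) {u v : List Layer} (a b : List Bool)
    {x : Bool} (s : Bool) (hu : run u [] = some (a ++ x :: (!x) :: b))
    (hv : run v (a ++ x :: (!x) :: b) = some []) :
    ofWord nabla (u ++ [⟨.cross s, a.length⟩, ⟨.cross s, a.length⟩] ++ v) =
      ofWord nabla (u ++ v) + (bif s then -X else X) *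
        ofWord nabla (u ++ [⟨.cap, a.length⟩, ⟨.cup x, a.length⟩] ++ v) := by
  have hv1 : run (⟨.cross s, a.length⟩ :: v) (a ++ (!x) :: x :: b) = some [] := by
    have := run_shiftBy [⟨.cross s, 0⟩] a ((!x) :: x :: b)
    change run (shiftBy a.length [⟨.cross s, 0⟩] ++ v) _ = _
    rw [KnotFamily.run_append, this]
    exact hv
  have hu1 : run (u ++ [⟨.cap, a.length⟩]) [] = some (a ++ b) :=
    run_append_shiftBy [⟨.cap, 0⟩] hu (by simp [run, Piece.act])
  have key := skein_antiparallel hn hu hv1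
  have e1 := ofWord_move_at (nabla := nabla) (l := [⟨.cross (!s), 0⟩, ⟨.cross (!!s), 0⟩]) (r := [])
    (.reidemeisterTwo (!s) a.length) hu hv rfl rfl
  have e2 := ofWord_move_at (nabla := nabla) (l := [⟨.cup (!x), 0⟩, ⟨.cross s, 0⟩])
    (r := [⟨.cup (!!x), 0⟩]) (m' := x :: (!x) :: b) (.reidemeisterOneCup (!x) s a.length) hu1 hv
    (by simp [run, Piece.act]) (by simp [run, Piece.act])
  simp only [shiftBy, List.map_cons, List.map_nil, List.append_assoc, List.cons_append,
    List.nil_append, Nat.add_zero, Bool.not_not] at key e1 e2 ⊢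
  rw [← e1, ← e2]
  cases s
  · simp only [Bool.not_false, cond_false] at key ⊢
    linear_combination key
  · simp only [Bool.not_true, cond_true] at key ⊢
    linear_combination -key

/-- A diagram with a split circle has Conway polynomial zero. -/
lemma ofWord_circle (hn : IsConwayPolynomial nabla) {u v : List Layer} (a b : List Bool)
    (x c : Bool) (hu : run u [] = some (a ++ x :: b)) (hv : run v (a ++ x :: b) = some []) :
    ofWord nabla (u ++ [⟨.cup c, a.length + 1⟩, ⟨.cap, a.length + 1⟩] ++ v) = 0 := by
  -- The circle is joined to its left neighbour by a crossing; either sign gives a mere kink.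
  have same : ofWord nabla (u ++ [⟨.cup x, a.length + 1⟩, ⟨.cap, a.length + 1⟩] ++ v) = 0 := by
    have hu1 : run (u ++ [⟨.cup x, a.length + 1⟩]) [] = some (a ++ x :: x :: (!x) :: b) :=
      run_append_shiftBy [⟨.cup x, 1⟩] hu rfl
    have hv1 : run (⟨.cap, a.length + 1⟩ :: v) (a ++ x :: x :: (!x) :: b) = some [] := by
      have := run_shiftBy [⟨.cap, 1⟩] a (x :: x :: (!x) :: b)
      rw [show run [⟨.cap, 1⟩] (x :: x :: (!x) :: b) = some (x :: b) by
        simp [run, Piece.act]] at this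
      change run (shiftBy a.length [⟨.cap, 1⟩] ++ v) _ = _
      rw [KnotFamily.run_append, this]
      exact hv
    have hu2 : run (u ++ [⟨.cup x, a.length⟩]) [] = some (a ++ x :: (!x) :: x :: b) :=
      run_append_shiftBy [⟨.cup x, 0⟩] hu rfl
    have key := skein_parallel hn hu1 hv1
    have kink (s : Bool) : ofWord nabla
        (u ++ [⟨.cup x, a.length + 1⟩] ++ [⟨.cross s, a.length⟩] ++ ⟨.cap, a.length + 1⟩ :: v) =
          ofWord nabla (u ++ v) := by
      have e1 := ofWord_move_at (nabla := nabla) (l := [⟨.cup x, 0⟩, ⟨.cross (!s), 1⟩])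
        (r := [⟨.cup x, 1⟩, ⟨.cross (!!s), 0⟩]) (.slideCup x (!s) a.length) hu hv1 rfl rfl
      have e2 := ofWord_move_at (nabla := nabla) (l := [⟨.cross (!s), 1⟩, ⟨.cap, 1⟩])
        (r := [⟨.cap, 1⟩]) (.reidemeisterOneCap (!s) (a.length + 1)) hu2 hv
        (by simp [run, Piece.act]) (by simp [run, Piece.act])
      have e3 := ofWord_move_at (nabla := nabla) (l := [⟨.cup x, 0⟩, ⟨.cap, 1⟩])
        (r := []) (.zigzagLeft x a.length) hu hv (by simp [run, Piece.act]) rfl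
      simp only [shiftBy, List.map_cons, List.map_nil, List.append_assoc, List.cons_append,
        List.nil_append, Nat.add_zero, Bool.not_not] at e1 e2 e3 ⊢
      rw [← e1, e2, e3]
    rw [kink, kink, sub_self] at key
    simpa [X_ne_zero] using key.symm
  by_cases hc : c = x
  · rw [hc]
    exact same
  · obtain rfl : c = !x := by cases c <;> cases x <;> simp_all
    have hu1 : run (u ++ [⟨.cup (!x), a.length + 1⟩]) [] = some (a ++ x :: (!x) :: x :: b) := by
      simpa [shiftBy] using run_append_shiftBy [⟨.cup (!x), 1⟩] hu rfl
    have hv1 : run (⟨.cap, a.length + 1⟩ :: v) (a ++ x :: x :: (!x) :: b) = some [] := by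
      have := run_shiftBy [⟨.cap, 1⟩] a (x :: x :: (!x) :: b)
      rw [show run [⟨.cap, 1⟩] (x :: x :: (!x) :: b) = some (x :: b) by
        simp [run, Piece.act]] at this
      change run (shiftBy a.length [⟨.cap, 1⟩] ++ v) _ = _
      rw [KnotFamily.run_append, this]
      exact hv
    have e1 := ofWord_move_at (nabla := nabla) (l := [⟨.cross true, 1⟩, ⟨.cap, 1⟩])
      (r := [⟨.cap, 1⟩]) (.reidemeisterOneCap true (a.length + 1)) hu1 hv
      (by simp [run, Piece.act]) (by simp [run, Piece.act])
    have e2 := ofWord_move_at (nabla := nabla) (l := [⟨.cup (!x), 1⟩, ⟨.cross true, 1⟩])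
      (r := [⟨.cup (!!x), 1⟩]) (.reidemeisterOneCup (!x) true (a.length + 1)) hu hv1
      (by simp [run, Piece.act]) (by simp [run, Piece.act])
    simp only [shiftBy, List.map_cons, List.map_nil, List.append_assoc, List.cons_append,
      List.nil_append, Bool.not_not] at same e1 e2 ⊢
    rw [← e1, e2, same]

end SkeinConsequences

/-! ### Diagrams with few crossings -/

section Computation

/-- A minimum whose left strand is upward. -/
abbrev cupU (i : ℕ) : Layer := ⟨.cup true, i⟩

/-- A minimum whose left strand is downward. -/
abbrev cupD (i : ℕ) : Layer := ⟨.cup false, i⟩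

/-- A maximum. -/
abbrev capAt (i : ℕ) : Layer := ⟨.cap, i⟩

/-- A crossing at which the strand from bottom left to top right runs over. -/
abbrev pos (i : ℕ) : Layer := ⟨.cross true, i⟩

/-- A crossing at which the strand from bottom left to top right runs under. -/
abbrev neg (i : ℕ) : Layer := ⟨.cross false, i⟩

/-- The lowest five layers of the diagrams in the family. The four strands above them are
oriented down, down, up, up. -/
abbrev stem : List Layer := [cupD 0, cupU 1, pos 0, pos 0, neg 1]

variable {nabla : OrientedLink → ℤ[X]}

lemma ofWord_unknot (hn : IsConwayPolynomial nabla) : ofWord nabla [cupU 0, capAt 0] = 1 := by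
  rw [← hn.1]
  exact (nabla_link ⟨[cupU 0, capAt 0], rfl⟩).symm

lemma ofWord_cupD_capAt :
    ofWord nabla [cupD 0, capAt 0] =
      ofWord nabla [cupU 0, capAt 0] := by
  calc ofWord nabla [cupD 0, capAt 0]
    _ = ofWord nabla [cupD 0, pos 0, capAt 0] :=
        (ofWord_move 1 (.reidemeisterOneCap true 0)).symm
    _ = ofWord nabla [cupU 0, capAt 0] :=
        ofWord_move 0 (.reidemeisterOneCup false true 0)

/-! ### The diagrams above the stem -/

lemma ofWord_stem_curl :
    ofWord nabla (stem ++ [cupU 3, capAt 1, capAt 0, capAt 0]) =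
      ofWord nabla (stem ++ [capAt 1, capAt 0]) := by
  calc ofWord nabla (stem ++ [cupU 3, capAt 1, capAt 0, capAt 0])
    _ = ofWord nabla (stem ++ [capAt 1, cupU 1, capAt 0, capAt 0]) :=
        (ofWord_move 5 (.exchange .cap (.cup true) 1 0)).symm
    _ = ofWord nabla (stem ++ [capAt 1, capAt 0]) :=
        ofWord_move 6 (.zigzagRight true 0)

lemma ofWord_stem_pos_curl :
    ofWord nabla (stem ++ [pos 2, cupU 3, capAt 1, capAt 0, capAt 0]) =
      ofWord nabla (stem ++ [neg 1, capAt 0, capAt 0]) := by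
  calc ofWord nabla (stem ++ [pos 2, cupU 3, capAt 1, capAt 0, capAt 0])
    _ = ofWord nabla (stem ++ [pos 2, capAt 1, cupU 1, capAt 0, capAt 0]) :=
        (ofWord_move 6 (.exchange .cap (.cup true) 1 0)).symm
    _ = ofWord nabla (stem ++ [pos 2, capAt 1, capAt 0]) :=
        ofWord_move 7 (.zigzagRight true 0)
    _ = ofWord nabla (stem ++ [neg 1, capAt 2, capAt 0]) :=
        ofWord_move 5 (.slideCap true 1)
    _ = ofWord nabla (stem ++ [neg 1, capAt 0, capAt 0]) :=
        (ofWord_move 6 (.exchange .cap .cap 0 0)).symm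

lemma ofWord_stem_curl_pos :
    ofWord nabla (stem ++ [cupU 3, pos 2, capAt 1, capAt 0, capAt 0]) =
      ofWord nabla (stem ++ [neg 1, capAt 0, capAt 0]) := by
  calc ofWord nabla (stem ++ [cupU 3, pos 2, capAt 1, capAt 0, capAt 0])
    _ = ofWord nabla (stem ++ [cupU 3, neg 1, capAt 2, capAt 0, capAt 0]) :=
        ofWord_move 6 (.slideCap true 1)
    _ = ofWord nabla (stem ++ [neg 1, cupU 3, capAt 2, capAt 0, capAt 0]) :=
        (ofWord_move 5 (.exchange (.cross false) (.cup true) 1 0)).symm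
    _ = ofWord nabla (stem ++ [neg 1, capAt 0, capAt 0]) :=
        ofWord_move 6 (.zigzagRight true 2)

/-- The diagram of `knotK 0` without its two outer clasps. In the next three lemmas, the lower, the
upper, or both clasps are smoothed instead of removed. -/
lemma ofWord_twist :
    ofWord nabla (stem ++ [cupU 2, pos 4, pos 3, pos 2, capAt 1, capAt 0, capAt 0]) =
      ofWord nabla (stem ++ [pos 2, cupU 3, capAt 1, capAt 0, capAt 0]) := by
  calc ofWord nabla (stem ++ [cupU 2, pos 4, pos 3, pos 2, capAt 1, capAt 0, capAt 0])
    _ = ofWord nabla (stem ++ [pos 2, cupU 2, pos 3, pos 2, capAt 1, capAt 0, capAt 0]) :=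
        ofWord_move 5 (.exchange (.cup true) (.cross true) 2 0)
    _ = ofWord nabla (stem ++ [pos 2, cupU 3, neg 2, pos 2, capAt 1, capAt 0, capAt 0]) :=
        ofWord_move 6 (.slideCup true true 2)
    _ = ofWord nabla (stem ++ [pos 2, cupU 3, capAt 1, capAt 0, capAt 0]) :=
        ofWord_move 7 (.reidemeisterTwo false 2)

/-- A circle splits off. -/
lemma ofWord_twist_lower :
    ofWord nabla (stem ++ [cupU 2, capAt 3, cupD 3, pos 4, pos 3, pos 2, capAt 1, capAt 0,
            capAt 0]) =
      ofWord nabla (stem ++ [pos 2, capAt 1, cupD 2, capAt 2, capAt 0]) := by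
  calc ofWord nabla (stem ++ [cupU 2, capAt 3, cupD 3, pos 4, pos 3, pos 2, capAt 1, capAt 0,
          capAt 0])
    _ = ofWord nabla (stem ++ [cupD 3, pos 4, pos 3, pos 2, capAt 1, capAt 0, capAt 0]) :=
        ofWord_move 5 (.zigzagLeft true 2)
    _ = ofWord nabla (stem ++ [cupD 4, neg 3, pos 3, pos 2, capAt 1, capAt 0, capAt 0]) :=
        ofWord_move 5 (.slideCup false true 3)
    _ = ofWord nabla (stem ++ [cupD 4, pos 2, capAt 1, capAt 0, capAt 0]) :=
        ofWord_move 6 (.reidemeisterTwo false 3)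
    _ = ofWord nabla (stem ++ [pos 2, cupD 4, capAt 1, capAt 0, capAt 0]) :=
        (ofWord_move 5 (.exchange (.cross true) (.cup false) 2 0)).symm
    _ = ofWord nabla (stem ++ [pos 2, capAt 1, cupD 2, capAt 0, capAt 0]) :=
        (ofWord_move 6 (.exchange .cap (.cup false) 1 1)).symm
    _ = ofWord nabla (stem ++ [pos 2, capAt 1, cupD 2, capAt 2, capAt 0]) :=
        ofWord_move 8 (.exchange .cap .cap 0 0)

/-- A circle splits off. -/
lemma ofWord_twist_upper :
    ofWord nabla (stem ++ [cupU 2, pos 4, pos 3, pos 2, capAt 3, cupU 3, capAt 1, capAt 0,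
            capAt 0]) =
      ofWord nabla (stem ++ [pos 2, cupU 2, capAt 2, cupU 3, capAt 1, capAt 0, capAt 0]) := by
  calc ofWord nabla (stem ++ [cupU 2, pos 4, pos 3, pos 2, capAt 3, cupU 3, capAt 1, capAt 0,
          capAt 0])
    _ = ofWord nabla (stem ++ [cupU 2, pos 4, pos 3, neg 3, capAt 2, cupU 3, capAt 1, capAt 0,
            capAt 0]) :=
        (ofWord_move 8 (.slideCap false 2)).symm
    _ = ofWord nabla (stem ++ [cupU 2, pos 4, capAt 2, cupU 3, capAt 1, capAt 0, capAt 0]) :=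
        ofWord_move 7 (.reidemeisterTwo true 3)
    _ = ofWord nabla (stem ++ [pos 2, cupU 2, capAt 2, cupU 3, capAt 1, capAt 0, capAt 0]) :=
        ofWord_move 5 (.exchange (.cup true) (.cross true) 2 0)

lemma ofWord_twist_lower_upper :
    ofWord nabla (stem ++ [cupU 2, capAt 3, cupD 3, pos 4, pos 3, pos 2, capAt 3, cupU 3, capAt 1,
            capAt 0, capAt 0]) =
      ofWord nabla (stem ++ [pos 2, cupU 3, capAt 1, capAt 0, capAt 0]) := by
  calc ofWord nabla (stem ++ [cupU 2, capAt 3, cupD 3, pos 4, pos 3, pos 2, capAt 3, cupU 3,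
          capAt 1, capAt 0, capAt 0])
    _ = ofWord nabla (stem ++ [cupD 3, pos 4, pos 3, pos 2, capAt 3, cupU 3, capAt 1, capAt 0,
            capAt 0]) :=
        ofWord_move 5 (.zigzagLeft true 2)
    _ = ofWord nabla (stem ++ [cupD 4, neg 3, pos 3, pos 2, capAt 3, cupU 3, capAt 1, capAt 0,
            capAt 0]) :=
        ofWord_move 5 (.slideCup false true 3)
    _ = ofWord nabla (stem ++ [cupD 4, pos 2, capAt 3, cupU 3, capAt 1, capAt 0, capAt 0]) :=
        ofWord_move 6 (.reidemeisterTwo false 3)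
    _ = ofWord nabla (stem ++ [pos 2, cupD 4, capAt 3, cupU 3, capAt 1, capAt 0, capAt 0]) :=
        (ofWord_move 5 (.exchange (.cross true) (.cup false) 2 0)).symm
    _ = ofWord nabla (stem ++ [pos 2, cupU 3, capAt 1, capAt 0, capAt 0]) :=
        ofWord_move 6 (.zigzagRight false 3)

/-- The diagram of `linkJ` without its two outer clasps. In the next three lemmas, the lower, the
upper, or both clasps are smoothed instead of removed. -/
lemma ofWord_smooth :
    ofWord nabla (stem ++ [cupU 2, pos 4, capAt 3, cupU 3, pos 2, capAt 1, capAt 0, capAt 0]) =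
      ofWord nabla (stem ++ [pos 2, neg 1, capAt 0, capAt 0]) := by
  calc ofWord nabla (stem ++ [cupU 2, pos 4, capAt 3, cupU 3, pos 2, capAt 1, capAt 0, capAt 0])
    _ = ofWord nabla (stem ++ [pos 2, cupU 2, capAt 3, cupU 3, pos 2, capAt 1, capAt 0, capAt 0]) :=
        ofWord_move 5 (.exchange (.cup true) (.cross true) 2 0)
    _ = ofWord nabla (stem ++ [pos 2, cupU 3, pos 2, capAt 1, capAt 0, capAt 0]) :=
        ofWord_move 6 (.zigzagLeft true 2)
    _ = ofWord nabla (stem ++ [pos 2, cupU 3, neg 1, capAt 2, capAt 0, capAt 0]) :=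
        ofWord_move 7 (.slideCap true 1)
    _ = ofWord nabla (stem ++ [pos 2, neg 1, cupU 3, capAt 2, capAt 0, capAt 0]) :=
        (ofWord_move 6 (.exchange (.cross false) (.cup true) 1 0)).symm
    _ = ofWord nabla (stem ++ [pos 2, neg 1, capAt 0, capAt 0]) :=
        ofWord_move 7 (.zigzagRight true 2)

lemma ofWord_smooth_lower :
    ofWord nabla (stem ++ [cupU 2, capAt 3, cupD 3, pos 4, capAt 3, cupU 3, pos 2, capAt 1,
            capAt 0, capAt 0]) =
      ofWord nabla (stem ++ [cupU 3, pos 2, capAt 1, capAt 0, capAt 0]) := by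
  calc ofWord nabla (stem ++ [cupU 2, capAt 3, cupD 3, pos 4, capAt 3, cupU 3, pos 2, capAt 1,
          capAt 0, capAt 0])
    _ = ofWord nabla (stem ++ [cupD 3, pos 4, capAt 3, cupU 3, pos 2, capAt 1, capAt 0, capAt 0]) :=
        ofWord_move 5 (.zigzagLeft true 2)
    _ = ofWord nabla (stem ++ [cupD 4, neg 3, capAt 3, cupU 3, pos 2, capAt 1, capAt 0, capAt 0]) :=
        ofWord_move 5 (.slideCup false true 3)
    _ = ofWord nabla (stem ++ [cupD 4, capAt 3, cupU 3, pos 2, capAt 1, capAt 0, capAt 0]) :=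
        ofWord_move 6 (.reidemeisterOneCap false 3)
    _ = ofWord nabla (stem ++ [cupU 3, pos 2, capAt 1, capAt 0, capAt 0]) :=
        ofWord_move 5 (.zigzagRight false 3)

lemma ofWord_smooth_upper :
    ofWord nabla (stem ++ [cupU 2, pos 4, capAt 3, cupU 3, pos 2, capAt 3, cupU 3, capAt 1,
            capAt 0, capAt 0]) =
      ofWord nabla (stem ++ [pos 2, cupU 3, capAt 1, capAt 0, capAt 0]) := by
  calc ofWord nabla (stem ++ [cupU 2, pos 4, capAt 3, cupU 3, pos 2, capAt 3, cupU 3, capAt 1,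
          capAt 0, capAt 0])
    _ = ofWord nabla (stem ++ [pos 2, cupU 2, capAt 3, cupU 3, pos 2, capAt 3, cupU 3, capAt 1,
            capAt 0, capAt 0]) :=
        ofWord_move 5 (.exchange (.cup true) (.cross true) 2 0)
    _ = ofWord nabla (stem ++ [pos 2, cupU 3, pos 2, capAt 3, cupU 3, capAt 1, capAt 0, capAt 0]) :=
        ofWord_move 6 (.zigzagLeft true 2)
    _ = ofWord nabla (stem ++ [pos 2, cupU 2, neg 3, capAt 3, cupU 3, capAt 1, capAt 0, capAt 0]) :=
        (ofWord_move 6 (.slideCup true false 2)).symm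
    _ = ofWord nabla (stem ++ [pos 2, cupU 2, capAt 3, cupU 3, capAt 1, capAt 0, capAt 0]) :=
        ofWord_move 7 (.reidemeisterOneCap false 3)
    _ = ofWord nabla (stem ++ [pos 2, cupU 3, capAt 1, capAt 0, capAt 0]) :=
        ofWord_move 6 (.zigzagLeft true 2)

lemma ofWord_smooth_lower_upper :
    ofWord nabla (stem ++ [cupU 2, capAt 3, cupD 3, pos 4, capAt 3, cupU 3, pos 2, capAt 3, cupU 3,
            capAt 1, capAt 0, capAt 0]) =
      ofWord nabla (stem ++ [cupU 3, capAt 1, capAt 0, capAt 0]) := by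
  calc ofWord nabla (stem ++ [cupU 2, capAt 3, cupD 3, pos 4, capAt 3, cupU 3, pos 2, capAt 3,
          cupU 3, capAt 1, capAt 0, capAt 0])
    _ = ofWord nabla (stem ++ [cupD 3, pos 4, capAt 3, cupU 3, pos 2, capAt 3, cupU 3, capAt 1,
            capAt 0, capAt 0]) :=
        ofWord_move 5 (.zigzagLeft true 2)
    _ = ofWord nabla (stem ++ [cupD 4, neg 3, capAt 3, cupU 3, pos 2, capAt 3, cupU 3, capAt 1,
            capAt 0, capAt 0]) :=
        ofWord_move 5 (.slideCup false true 3)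
    _ = ofWord nabla (stem ++ [cupD 4, capAt 3, cupU 3, pos 2, capAt 3, cupU 3, capAt 1, capAt 0,
            capAt 0]) :=
        ofWord_move 6 (.reidemeisterOneCap false 3)
    _ = ofWord nabla (stem ++ [cupU 3, pos 2, capAt 3, cupU 3, capAt 1, capAt 0, capAt 0]) :=
        ofWord_move 5 (.zigzagRight false 3)
    _ = ofWord nabla (stem ++ [cupU 2, neg 3, capAt 3, cupU 3, capAt 1, capAt 0, capAt 0]) :=
        (ofWord_move 5 (.slideCup true false 2)).symm
    _ = ofWord nabla (stem ++ [cupU 2, capAt 3, cupU 3, capAt 1, capAt 0, capAt 0]) :=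
        ofWord_move 6 (.reidemeisterOneCap false 3)
    _ = ofWord nabla (stem ++ [cupU 3, capAt 1, capAt 0, capAt 0]) :=
        ofWord_move 5 (.zigzagLeft true 2)

/-- The clasps above and below the twisted strands of the knot `K 0` are opened. -/
lemma ofWord_knot_zero (hn : IsConwayPolynomial nabla) :
    ofWord nabla (stem ++ [cupU 2, neg 3, neg 3, pos 4, pos 3, pos 2, neg 3, neg 3,
      capAt 1, capAt 0, capAt 0]) =
      (1 + X ^ 2) * ofWord nabla (stem ++ [neg 1, capAt 0, capAt 0]) := by
  have h1 := ofWord_clasp hn (x := true)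
    (u := stem ++ [cupU 2, neg 3, neg 3, pos 4, pos 3, pos 2]) (v := [capAt 1, capAt 0, capAt 0])
    [false, false, true] [true] false rfl rfl
  have h2 := ofWord_clasp hn (x := false)
    (u := stem ++ [cupU 2]) (v := [pos 4, pos 3, pos 2, capAt 1, capAt 0, capAt 0])
    [false, false, true] [true] false rfl rfl
  have h3 := ofWord_clasp hn (x := false) (u := stem ++ [cupU 2])
    (v := [pos 4, pos 3, pos 2, capAt 3, cupU 3, capAt 1, capAt 0, capAt 0])
    [false, false, true] [true] false rfl rfl
  have h4 := ofWord_circle hn (u := stem ++ [pos 2, capAt 1]) (v := [capAt 0])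
    [false] [] true false rfl rfl
  have h5 := ofWord_circle hn (u := stem ++ [pos 2]) (v := [cupU 3, capAt 1, capAt 0, capAt 0])
    [false] [true, true] false true rfl rfl
  have e1 := ofWord_twist.trans (ofWord_stem_pos_curl (nabla := nabla))
  have e2 := ofWord_twist_lower (nabla := nabla)
  have e3 := ofWord_twist_upper (nabla := nabla)
  have e4 := ofWord_twist_lower_upper.trans (ofWord_stem_pos_curl (nabla := nabla))
  simp only [List.length_cons, List.length_nil, List.cons_append, List.nil_append, cond_false,
    Nat.zero_add, Nat.reduceAdd] at *
  linear_combination h1 + h2 + X * h3 + e1 + X * e2 + X * h4 + X * e3 + X * h5 + X ^ 2 * e4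

/-- The clasps above and below the smoothed crossing of the link `J` are opened. -/
lemma ofWord_smoothed (hn : IsConwayPolynomial nabla) :
    ofWord nabla (stem ++ [cupU 2, neg 3, neg 3, pos 4, capAt 3, cupU 3, pos 2, neg 3, neg 3,
      capAt 1, capAt 0, capAt 0]) =
      ofWord nabla (stem ++ [pos 2, neg 1, capAt 0, capAt 0]) +
        2 * X * ofWord nabla (stem ++ [neg 1, capAt 0, capAt 0]) +
        X ^ 2 * ofWord nabla (stem ++ [capAt 1, capAt 0]) := by
  have h1 := ofWord_clasp hn (x := true)
    (u := stem ++ [cupU 2, neg 3, neg 3, pos 4, capAt 3, cupU 3, pos 2])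
    (v := [capAt 1, capAt 0, capAt 0]) [false, false, true] [true] false rfl rfl
  have h2 := ofWord_clasp hn (x := false) (u := stem ++ [cupU 2])
    (v := [pos 4, capAt 3, cupU 3, pos 2, capAt 1, capAt 0, capAt 0])
    [false, false, true] [true] false rfl rfl
  have h3 := ofWord_clasp hn (x := false) (u := stem ++ [cupU 2])
    (v := [pos 4, capAt 3, cupU 3, pos 2, capAt 3, cupU 3, capAt 1, capAt 0, capAt 0])
    [false, false, true] [true] false rfl rfl
  have e1 := ofWord_smooth (nabla := nabla)
  have e2 := ofWord_smooth_lower.trans (ofWord_stem_curl_pos (nabla := nabla))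
  have e3 := ofWord_smooth_upper.trans (ofWord_stem_pos_curl (nabla := nabla))
  have e4 := ofWord_smooth_lower_upper.trans (ofWord_stem_curl (nabla := nabla))
  simp only [List.length_cons, List.length_nil, List.cons_append, List.nil_append, cond_false,
    Nat.zero_add, Nat.reduceAdd] at *
  linear_combination h1 + h2 + X * h3 + e1 + X * e2 + X * e3 + X ^ 2 * e4

/-! ### The remaining diagrams -/

/-- The first of three diagrams on the stem,
        with the clasp of the stem removed. In the lemmas below,
this clasp is removed (`unclasped`) or smoothed (`smoothed`) in each of the three. -/
lemma ofWord_unclasped_hopf :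
    ofWord nabla [cupD 0, cupU 1, neg 1, neg 1, capAt 0, capAt 0] =
      ofWord nabla [cupD 0, capAt 0] := by
  calc ofWord nabla [cupD 0, cupU 1, neg 1, neg 1, capAt 0, capAt 0]
    _ = ofWord nabla [cupD 0, cupD 1, neg 1, capAt 0, capAt 0] :=
        ofWord_move 1 (.reidemeisterOneCup true false 1)
    _ = ofWord nabla [cupD 0, cupU 1, capAt 0, capAt 0] :=
        ofWord_move 1 (.reidemeisterOneCup false false 1)
    _ = ofWord nabla [cupD 0, capAt 0] :=
        ofWord_move 1 (.zigzagRight true 0)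

lemma ofWord_smoothed_hopf :
    ofWord nabla [cupD 0, cupU 1, capAt 0, cupD 0, neg 1, neg 1, capAt 0, capAt 0] =
      ofWord nabla [cupD 0, cupD 0, neg 1, neg 1, capAt 0, capAt 0] := by
  calc ofWord nabla [cupD 0, cupU 1, capAt 0, cupD 0, neg 1, neg 1, capAt 0, capAt 0]
    _ = ofWord nabla [cupD 0, cupD 0, neg 1, neg 1, capAt 0, capAt 0] :=
        ofWord_move 1 (.zigzagRight true 0)

lemma ofWord_unlink :
    ofWord nabla [cupD 0, cupD 0, capAt 0, capAt 0] =
      ofWord nabla [cupD 0, cupD 2, capAt 2, capAt 0] := by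
  calc ofWord nabla [cupD 0, cupD 0, capAt 0, capAt 0]
    _ = ofWord nabla [cupD 0, cupD 2, capAt 0, capAt 0] :=
        (ofWord_move 0 (.exchange (.cup false) (.cup false) 0 0)).symm
    _ = ofWord nabla [cupD 0, cupD 2, capAt 2, capAt 0] :=
        ofWord_move 2 (.exchange .cap .cap 0 0)

lemma ofWord_hopf_smoothed :
    ofWord nabla [cupD 0, cupD 0, capAt 1, cupU 1, capAt 0, capAt 0] =
      ofWord nabla [cupD 0, capAt 0] := by
  calc ofWord nabla [cupD 0, cupD 0, capAt 1, cupU 1, capAt 0, capAt 0]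
    _ = ofWord nabla [cupD 0, cupU 1, capAt 0, capAt 0] :=
        ofWord_move 1 (.zigzagLeft false 0)
    _ = ofWord nabla [cupD 0, capAt 0] :=
        ofWord_move 1 (.zigzagRight true 0)

lemma ofWord_unclasped_trefoil :
    ofWord nabla [cupD 0, cupU 1, neg 1, pos 2, neg 1, capAt 0, capAt 0] =
      ofWord nabla [cupD 0, cupD 0, neg 1, neg 1, capAt 0, capAt 0] := by
  calc ofWord nabla [cupD 0, cupU 1, neg 1, pos 2, neg 1, capAt 0, capAt 0]
    _ = ofWord nabla [cupD 0, cupD 1, pos 2, neg 1, capAt 0, capAt 0] :=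
        ofWord_move 1 (.reidemeisterOneCup true false 1)
    _ = ofWord nabla [cupD 0, cupD 2, neg 1, neg 1, capAt 0, capAt 0] :=
        ofWord_move 1 (.slideCup false true 1)
    _ = ofWord nabla [cupD 0, cupD 0, neg 1, neg 1, capAt 0, capAt 0] :=
        ofWord_move 0 (.exchange (.cup false) (.cup false) 0 0)

lemma ofWord_smoothed_trefoil :
    ofWord nabla [cupD 0, cupU 1, capAt 0, cupD 0, neg 1, pos 2, neg 1, capAt 0, capAt 0] =
      ofWord nabla [cupD 0, cupD 0, neg 1, pos 2, neg 1, capAt 0, capAt 0] := by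
  calc ofWord nabla [cupD 0, cupU 1, capAt 0, cupD 0, neg 1, pos 2, neg 1, capAt 0, capAt 0]
    _ = ofWord nabla [cupD 0, cupD 0, neg 1, pos 2, neg 1, capAt 0, capAt 0] :=
        ofWord_move 1 (.zigzagRight true 0)

/-- A crossing change makes the trefoil trivial. -/
lemma ofWord_trefoil_changed :
    ofWord nabla [cupD 0, cupD 0, neg 1, neg 2, neg 1, capAt 0, capAt 0] =
      ofWord nabla [cupU 0, capAt 0] := by
  calc ofWord nabla [cupD 0, cupD 0, neg 1, neg 2, neg 1, capAt 0, capAt 0]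
    _ = ofWord nabla [cupD 0, cupD 0, neg 2, neg 1, neg 2, capAt 0, capAt 0] :=
        ofWord_move 2 (.reidemeisterThree false false false 1 (.inl rfl))
    _ = ofWord nabla [cupD 0, cupD 2, neg 2, neg 1, neg 2, capAt 0, capAt 0] :=
        (ofWord_move 0 (.exchange (.cup false) (.cup false) 0 0)).symm
    _ = ofWord nabla [cupD 0, cupU 2, neg 1, neg 2, capAt 0, capAt 0] :=
        ofWord_move 1 (.reidemeisterOneCup false false 2)
    _ = ofWord nabla [cupD 0, cupU 2, neg 1, capAt 0, neg 0, capAt 0] :=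
        (ofWord_move 3 (.exchange .cap (.cross false) 0 0)).symm
    _ = ofWord nabla [cupD 0, cupU 2, neg 1, capAt 0, capAt 0] :=
        ofWord_move 4 (.reidemeisterOneCap false 0)
    _ = ofWord nabla [cupD 0, cupU 2, pos 0, capAt 1, capAt 0] :=
        ofWord_move 2 (.slideCap false 0)
    _ = ofWord nabla [cupD 0, pos 0, cupU 2, capAt 1, capAt 0] :=
        (ofWord_move 1 (.exchange (.cross true) (.cup true) 0 0)).symm
    _ = ofWord nabla [cupU 0, cupU 2, capAt 1, capAt 0] :=
        ofWord_move 0 (.reidemeisterOneCup false true 0)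
    _ = ofWord nabla [cupU 0, capAt 0] :=
        ofWord_move 1 (.zigzagRight true 1)

lemma ofWord_unclasped_unknot :
    ofWord nabla [cupD 0, cupU 1, neg 1, capAt 1, capAt 0] =
      ofWord nabla [cupD 0, cupD 1, capAt 1, capAt 0] := by
  calc ofWord nabla [cupD 0, cupU 1, neg 1, capAt 1, capAt 0]
    _ = ofWord nabla [cupD 0, cupD 1, capAt 1, capAt 0] :=
        ofWord_move 1 (.reidemeisterOneCup true false 1)

lemma ofWord_smoothed_unknot :
    ofWord nabla [cupD 0, cupU 1, capAt 0, cupD 0, neg 1, capAt 1, capAt 0] =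
      ofWord nabla [cupD 0, capAt 0] := by
  calc ofWord nabla [cupD 0, cupU 1, capAt 0, cupD 0, neg 1, capAt 1, capAt 0]
    _ = ofWord nabla [cupD 0, cupD 0, neg 1, capAt 1, capAt 0] :=
        ofWord_move 1 (.zigzagRight true 0)
    _ = ofWord nabla [cupD 0, cupD 0, capAt 1, capAt 0] :=
        ofWord_move 2 (.reidemeisterOneCap false 1)
    _ = ofWord nabla [cupD 0, capAt 0] :=
        ofWord_move 1 (.zigzagLeft false 0)

/-- The Hopf link. -/
lemma ofWord_hopf (hn : IsConwayPolynomial nabla) :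
    ofWord nabla [cupD 0, cupD 0, neg 1, neg 1, capAt 0, capAt 0] = X := by
  have h1 := ofWord_clasp hn (x := true) (u := [cupD 0, cupD 0]) (v := [capAt 0, capAt 0])
    [false] [true] false rfl rfl
  have h2 := ofWord_circle hn (u := [cupD 0]) (v := [capAt 0]) [false] [] true false rfl rfl
  have e1 := ofWord_unlink (nabla := nabla)
  have e2 := ofWord_hopf_smoothed.trans (ofWord_cupD_capAt.trans (ofWord_unknot hn))
  simp only [List.length_cons, List.length_nil, List.cons_append, List.nil_append, cond_false,
    Nat.zero_add, Nat.reduceAdd] at *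
  linear_combination h1 + e1 + h2 + X * e2

/-- The trefoil knot. -/
lemma ofWord_trefoil (hn : IsConwayPolynomial nabla) :
    ofWord nabla [cupD 0, cupD 0, neg 1, pos 2, neg 1, capAt 0, capAt 0] = 1 + X ^ 2 := by
  have h1 := skein_parallel hn (x := true) (u := [cupD 0, cupD 0, neg 1])
    (v := [neg 1, capAt 0, capAt 0]) (a := [false, false]) (b := []) rfl rfl
  have e1 := ofWord_hopf hn
  have e2 := ofWord_trefoil_changed.trans (ofWord_unknot hn)
  simp only [List.length_cons, List.length_nil, List.cons_append, List.nil_append,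
    Nat.zero_add, Nat.reduceAdd] at *
  linear_combination h1 + X * e1 + e2

lemma ofWord_stem_neg (hn : IsConwayPolynomial nabla) :
    ofWord nabla (stem ++ [neg 1, capAt 0, capAt 0]) = 1 - X ^ 2 := by
  have h1 := ofWord_clasp hn (x := false) (u := [cupD 0, cupU 1])
    (v := [neg 1, neg 1, capAt 0, capAt 0]) [] [false, true] true rfl rfl
  have e1 := ofWord_unclasped_hopf.trans (ofWord_cupD_capAt.trans (ofWord_unknot hn))
  have e2 := ofWord_smoothed_hopf.trans (ofWord_hopf hn)
  simp only [List.length_nil, List.cons_append, List.nil_append, cond_true] at *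
  linear_combination h1 + e1 - X * e2

lemma ofWord_stem_pos_neg (hn : IsConwayPolynomial nabla) :
    ofWord nabla (stem ++ [pos 2, neg 1, capAt 0, capAt 0]) = -X ^ 3 := by
  have h1 := ofWord_clasp hn (x := false) (u := [cupD 0, cupU 1])
    (v := [neg 1, pos 2, neg 1, capAt 0, capAt 0]) [] [false, true] true rfl rfl
  have e1 := ofWord_unclasped_trefoil.trans (ofWord_hopf hn)
  have e2 := ofWord_smoothed_trefoil.trans (ofWord_trefoil hn)
  simp only [List.length_nil, List.cons_append, List.nil_append, cond_true] at *
  linear_combination h1 + e1 - X * e2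

lemma ofWord_stem_caps (hn : IsConwayPolynomial nabla) :
    ofWord nabla (stem ++ [capAt 1, capAt 0]) = -X := by
  have h1 := ofWord_clasp hn (x := false) (u := [cupD 0, cupU 1])
    (v := [neg 1, capAt 1, capAt 0]) [] [false, true] true rfl rfl
  have h2 := ofWord_circle hn (u := [cupD 0]) (v := [capAt 0]) [] [true] false false rfl rfl
  have e1 := ofWord_unclasped_unknot (nabla := nabla)
  have e2 := ofWord_smoothed_unknot.trans (ofWord_cupD_capAt.trans (ofWord_unknot hn))
  simp only [List.length_nil, List.cons_append, List.nil_append, cond_true] at *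
  linear_combination h1 + e1 + h2 - X * e2

end Computation

/-! ### The family of knots -/

section Family

open KnotFamily

variable {nabla : OrientedLink → ℤ[X]}

/-- The diagram of the family with the odd number `2 * k + 1` of crossings `.cross s` in the block
of twisted strands. -/
def oddTwists (s : Bool) (k : ℕ) : List Layer :=
  lower ++ List.replicate (2 * k + 1) ⟨.cross s, 3⟩ ++ upper

lemma run_replicate_even (s : Bool) (k : ℕ) (x : Bool) :
    run (List.replicate (2 * k) ⟨.cross s, 3⟩) [false, false, true, x, !x, true] =
      some [false, false, true, x, !x, true] := by
  induction k with
  | zero => rfl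
  | succ k ih => exact ih

lemma run_twists_upper (s : Bool) (k : ℕ) :
    run (List.replicate (2 * k) ⟨.cross s, 3⟩ ++ upper) [false, false, true, true, false, true] =
      some [] := by
  rw [run_append, show [false, false, true, true, false, true] =
    [false, false, true, true, !true, true] from rfl, run_replicate_even]
  rfl

/-- The kinks that remain when one of the twisted crossings is smoothed can be removed in pairs. -/
lemma ofWord_smoothed_twists (s : Bool) (k : ℕ) :
    ofWord nabla (lower ++ [⟨.cap, 3⟩, ⟨.cup true, 3⟩] ++
      (List.replicate (2 * k) ⟨.cross s, 3⟩ ++ upper)) = nabla linkJ := by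
  induction k with
  | zero => exact (nabla_link ⟨_, rfl⟩).symm
  | succ k ih =>
    rw [← ih]
    have hv := run_twists_upper s k
    have e1 := ofWord_append_move (nabla := nabla) (u := lower ++ [⟨.cap, 3⟩])
      (v := ⟨.cross s, 3⟩ :: (List.replicate (2 * k) ⟨.cross s, 3⟩ ++ upper))
      (.reidemeisterOneCup true s 3) hv hv
    have e2 := ofWord_append_move (nabla := nabla) (u := lower ++ [⟨.cap, 3⟩])
      (v := List.replicate (2 * k) ⟨.cross s, 3⟩ ++ upper)
      (.reidemeisterOneCup false s 3) hv hv
    exact e1.trans e2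

/-- The skein relation at the lowest of the twisted crossings. -/
lemma skein_twists (hn : IsConwayPolynomial nabla) (s : Bool) (k : ℕ) :
    ofWord nabla (lower ++ [⟨.cross false, 3⟩] ++
        (List.replicate (2 * k) ⟨.cross s, 3⟩ ++ upper)) -
      ofWord nabla (lower ++ [⟨.cross true, 3⟩] ++
        (List.replicate (2 * k) ⟨.cross s, 3⟩ ++ upper)) = X * nabla linkJ := by
  rw [← ofWord_smoothed_twists (nabla := nabla) s k]
  exact skein_antiparallel hn (x := false) (a := [false, false, true]) (b := [true]) rfl
    (run_twists_upper s k)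

/-- A crossing of the other sign cancels one of the twisted crossings. -/
lemma ofWord_cancel_twists (s : Bool) (k : ℕ) :
    ofWord nabla (lower ++ [⟨.cross (!s), 3⟩] ++
        (List.replicate (2 * (k + 1)) ⟨.cross s, 3⟩ ++ upper)) =
      ofWord nabla (oddTwists s k) := by
  have hu : run lower [] = some [false, false, true, false, true, true] := rfl
  have hl : run (lower ++ [⟨.cross (!s), 3⟩, ⟨.cross s, 3⟩] ++
      (List.replicate (2 * k + 1) ⟨.cross s, 3⟩ ++ upper)) [] = some [] := by
    rw [run_append, run_append, hu]
    exact run_twists_upper s k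
  have hr : run (lower ++ [] ++
      (List.replicate (2 * k + 1) ⟨.cross s, 3⟩ ++ upper)) [] = some [] := by
    rw [run_append, run_append, hu]
    exact run_twists_upper s k
  have e := ofWord_append_move (nabla := nabla)
    (by simpa using LocalMove.reidemeisterTwo (!s) 3) hl hr
  rw [oddTwists, List.append_assoc]
  exact e

lemma ofWord_oddTwists_false (hn : IsConwayPolynomial nabla) (k : ℕ) :
    ofWord nabla (oddTwists false k) =
      ofWord nabla (oddTwists true 0) + ((k : ℤ[X]) + 1) * X * nabla linkJ := by
  induction k with
  | zero =>
    have := skein_twists hn true 0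
    change ofWord nabla (oddTwists false 0) - ofWord nabla (oddTwists true 0) = _ at this
    push_cast
    linear_combination this
  | succ k ih =>
    have := skein_twists hn false (k + 1)
    have e := ofWord_cancel_twists (nabla := nabla) false k
    change ofWord nabla (oddTwists false (k + 1)) - _ = _ at this
    push_cast
    simp only [Bool.not_false] at e
    linear_combination this + e + ih

lemma ofWord_oddTwists_true (hn : IsConwayPolynomial nabla) (k : ℕ) :
    ofWord nabla (oddTwists true k) =
      ofWord nabla (oddTwists true 0) - (k : ℤ[X]) * X * nabla linkJ := by
  induction k with
  | zero => simp
  | succ k ih =>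
    have := skein_twists hn true (k + 1)
    have e := ofWord_cancel_twists (nabla := nabla) true k
    change _ - ofWord nabla (oddTwists true (k + 1)) = _ at this
    push_cast
    simp only [Bool.not_true] at e
    linear_combination -this + e + ih

/-- Passing from `n` to `n + 1` adds `X` times the Conway polynomial of the smoothed link; the
diagram of `knotK 0` is `oddTwists true 0`. -/
lemma nabla_knotK_eq (hn : IsConwayPolynomial nabla) (n : ℤ) :
    nabla (knotK n) = ofWord nabla (oddTwists true 0) + (n : ℤ[X]) * X * nabla linkJ := by
  rw [knotK, nabla_link (nabla := nabla)]
  rcases le_or_gt n 0 with h | h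
  · obtain ⟨k, rfl⟩ : ∃ k : ℕ, n = -k := ⟨n.natAbs, by omega⟩
    have hk : halfTwists (2 * -(k : ℤ) - 1) = List.replicate (2 * k + 1) ⟨.cross true, 3⟩ := by
      rw [halfTwists, show (2 * -(k : ℤ) - 1).natAbs = 2 * k + 1 by omega,
        decide_eq_true (by omega)]
    simp only [hk]
    rw [← oddTwists, ofWord_oddTwists_true hn]
    push_cast
    ring
  · obtain ⟨k, rfl⟩ : ∃ k : ℕ, n = k + 1 := ⟨n.natAbs - 1, by omega⟩
    have hk : halfTwists (2 * ((k : ℤ) + 1) - 1) =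
        List.replicate (2 * k + 1) ⟨.cross false, 3⟩ := by
      rw [halfTwists, show (2 * ((k : ℤ) + 1) - 1).natAbs = 2 * k + 1 by omega,
        decide_eq_false (by omega)]
    simp only [hk]
    rw [← oddTwists, ofWord_oddTwists_false hn]
    push_cast
    ring

lemma nabla_linkJ (hn : IsConwayPolynomial nabla) : nabla linkJ = -4 * X ^ 3 + 2 * X := by
  have h : nabla linkJ = ofWord nabla (stem ++ [cupU 2, neg 3, neg 3, pos 4, capAt 3, cupU 3,
      pos 2, neg 3, neg 3, capAt 1, capAt 0, capAt 0]) := nabla_link ⟨_, rfl⟩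
  rw [h, ofWord_smoothed hn, ofWord_stem_pos_neg hn, ofWord_stem_neg hn, ofWord_stem_caps hn]
  ring

lemma nabla_knotK (hn : IsConwayPolynomial nabla) (n : ℤ) :
    nabla (knotK n) = -C (4 * n + 1) * X ^ 4 + C (2 * n) * X ^ 2 + 1 := by
  have h : ofWord nabla (oddTwists true 0) = (1 + X ^ 2) * (1 - X ^ 2) := by
    rw [← ofWord_stem_neg hn, ← ofWord_knot_zero hn]
    rfl
  rw [nabla_knotK_eq hn, h, nabla_linkJ hn]
  simp only [map_add, map_mul, map_one, map_ofNat, eq_intCast]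
  ring

end Family

end LinkDiagram

theorem proposition3p1 :
    (∃ nabla : OrientedLink → ℤ[X], IsConwayPolynomial nabla) ∧
    (∀ nabla : OrientedLink → ℤ[X], IsConwayPolynomial nabla →
      nabla linkJ = -4 * X ^ 3 + 2 * X ∧
      ∀ n : ℤ, nabla (knotK n) = -C (4 * n + 1) * X ^ 4 + C (2 * n) * X ^ 2 + 1) ∧
    (∀ m n : ℤ, m ≠ n → knotK m ≠ knotK n) := by
  refine ⟨exists_isConwayPolynomial, fun nabla hn => ⟨nabla_linkJ hn, nabla_knotK hn⟩,
    fun m n hmn h => hmn ?_⟩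
  obtain ⟨nabla, hn⟩ := exists_isConwayPolynomial
  -- The coefficient of `X ^ 2` is `2 * n`.
  have key := congrArg (fun L => (nabla L).coeff 2) h
  simp only [nabla_knotK hn, ← C_neg, coeff_add, coeff_C_mul, coeff_X_pow, coeff_one] at key
  norm_num at key
  exact key
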